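/- **Notation.** For $p\ge 1$ let $\|\cdot\|_p$ be the $\ell_p$-norm; $v_S$ is the vector $v$ with all entries outside $S$ set to zero; $\sigma_s(x)_1=\inf\{\|x-z\|_1: z \text{ has at most } s \text{ non-zero entries}\}$. A matrix $A\in\mathbb{R}^{m\times n}$ has the $\ell_q$-robust null space property ($\ell_q$-NSP) of order $s$ with parameters $\rho,\tau$ if $\|v_S\|_q\le \rho\, s^{-(1-1/q)}\|v_{S^c}\|_1+\tau\|Av\|_2$ for all $v\in\mathbb{R}^n$ and all $S\subset\{1,\dots,n\}$ with $|S|\le s$. A random vector $X\in\mathbb{R}^d$ is sub-isotropic if $\mathbb{E}\langle X,v\rangle^2\ge\|v\|_2^2$ for all $v\in\mathbb{R}^d$, and $1$-subgaussian if $\mathbb{E}\exp(t\langle X,v\rangle)\le\exp(t^2)$ for all $t\in\mathbb{R}$ and all $v\in\mathbb{R}^d$ with $\|v\|_2\le 1$. A solution of the non-negative least squares problem (NNLS) for $y\in\mathbb{R}^m$ is a minimizer of $\|y-Ax\|_2$ over all $x\in\mathbb{R}^n$ with non-negative entries. **Theorem.** Let $\rho\in(0,1/3)$ and $q\in[2,\infty)$,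 and let $1\le s\le n$ and $m$ be integers with $$m\ \ge\ \frac{2\cdot 384^2}{\rho^2}\,s^{2-2/q}\Big(2+\sqrt{\log(en/s)}\Big)^2+1 .$$ Then there is a number $\tau>0$, depending only on $\rho,q,m,n,s$, with $$\frac1\tau\ \ge\ \frac{\sqrt{m-1}}{16}-\frac{3s^{1-1/q}}{\rho}\,8\sqrt2\,\Big(2+\sqrt{\log(en/s)}\Big),$$ such that the following holds. Let $\mu>0$ and let $A\in\mathbb{R}^{m\times n}$ be a random matrix with rows $a_i=a_{0,i}+\mu\mathbf 1^T$, where $a_{0,1},\dots,a_{0,m}$ are independent copies of a sub-isotropic and $1$-subgaussian random vector $a_0\in\mathbb{R}^n$, and suppose that the columns of the matrix with rows $a_{0,i}$ are $1$-subgaussian random vectors in $\mathbb{R}^m$ as well. Put $W=\operatorname{diag}(A^Tt)$ with $t=\frac1{m\mu}\mathbf 1\in\mathbb{R}^m$, $\kappa=\|W\|\,\|W^{-1}\|$ (spectral norms), and $$C=2\,\frac{\kappa(1+\kappa\rho)^2}{1-\kappa\rho},\qquad D=2\,\frac{3+\kappa\rho}{1-\kappa\rho}\max\{\kappa,\|W^{-1}\|\}.$$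 Then, with probability at least $$1-e^{-(m-1)/64}-2n\exp\!\Big(-\frac{\mu^2m}{16}\Big),$$ $A$ has the $\ell_q$-NSP of order $s$ with parameters $\rho$ and $\tau$, all entries of $A^Tt$ are positive, $\kappa<3$ and $\|W^{-1}\|<2$, and for every $p\in[1,q]$, every $x_0\in\mathbb{R}^n$ with non-negative entries and every $\mathbf n\in\mathbb{R}^m$, each solution $\hat x$ of the NNLS for $y=Ax_0+\mathbf n$ satisfies $$\|\hat x-x_0\|_p\ \le\ \frac{C}{s^{1-1/p}}\,\sigma_s(x_0)_1+\frac{D}{s^{1/q-1/p}}\Big(\frac{1}{\sqrt m\,\mu}+\tau\Big)\|\mathbf n\|_2 .$$ -/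

import Mathlib

open MeasureTheory ProbabilityTheory

namespace BiasedNNLS

noncomputable section

/-- The `ℓ_p`-norm of a vector in `ℝ^ι`, for a real exponent `p ≥ 1`. -/
def ellNorm {ι : Type*} [Fintype ι] (p : ℝ) (x : ι → ℝ) : ℝ :=
  ‖(WithLp.toLp (ENNReal.ofReal p) x : PiLp (ENNReal.ofReal p) (fun _ : ι => ℝ))‖

theorem ellNorm_eq_sum {ι : Type*} [Fintype ι] {p : ℝ} (hp : 0 < p) (x : ι → ℝ) :
    ellNorm p x = (∑ i, |x i| ^ p) ^ (1 / p) := by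
  have h : (ENNReal.ofReal p).toReal = p := ENNReal.toReal_ofReal hp.le
  unfold ellNorm
  rw [PiLp.norm_eq_sum (by rw [h]; exact hp), h]
  simp [Real.norm_eq_abs]

/-- The error `σ_s(x)_p` of the best `s`-term approximation of `x` in the `ℓ_p`-norm. -/
def bestApproxError {n : ℕ} (s : ℕ) (p : ℝ) (x : Fin n → ℝ) : ℝ :=
  ⨅ z : {z : Fin n → ℝ // (Finset.univ.filter fun i => z i ≠ 0).card ≤ s}, ellNorm p (x - z.1)

/-- The `ℓ_q`-robust null space property of order `s` with respect to the `ℓ₂`-norm, with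
parameters `ρ` and `τ`; `(S : Set _).indicator v` is the vector `v_S`. -/
def NullSpaceProperty {m n : ℕ} (A : Matrix (Fin m) (Fin n) ℝ) (q : ℝ) (s : ℕ) (ρ τ : ℝ) : Prop :=
  ∀ (v : Fin n → ℝ) (S : Finset (Fin n)), S.card ≤ s →
    ellNorm q ((S : Set (Fin n)).indicator v) ≤
      ρ / (s : ℝ) ^ (1 - 1 / q) * ellNorm 1 ((S : Set (Fin n))ᶜ.indicator v)
        + τ * ellNorm 2 (A.mulVec v)

/-- `x` is a solution of the non-negative least squares problem
`min ‖y - A x‖₂` over the vectors `x` with non-negative coordinates. -/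
def IsNNLSSolution {m n : ℕ} (A : Matrix (Fin m) (Fin n) ℝ) (y : Fin m → ℝ)
    (x : Fin n → ℝ) : Prop :=
  (∀ i, 0 ≤ x i) ∧
    ∀ z : Fin n → ℝ, (∀ i, 0 ≤ z i) → ellNorm 2 (y - A.mulVec x) ≤ ellNorm 2 (y - A.mulVec z)

/-- The spectral norm (the operator norm with respect to the Euclidean norm). -/
def specNorm {n : ℕ} (M : Matrix (Fin n) (Fin n) ℝ) : ℝ :=
  ‖Matrix.toEuclideanCLM (n := Fin n) (𝕜 := ℝ) M‖

/-- The diagonal matrix `W = diag(Aᵀ t)`. -/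
def weight {m n : ℕ} (A : Matrix (Fin m) (Fin n) ℝ) (t : Fin m → ℝ) : Matrix (Fin n) (Fin n) ℝ :=
  Matrix.diagonal (A.transpose.mulVec t)

/-- The condition number `κ = ‖W‖ ‖W⁻¹‖` of `W = diag(Aᵀ t)`. -/
def condNumber {m n : ℕ} (A : Matrix (Fin m) (Fin n) ℝ) (t : Fin m → ℝ) : ℝ :=
  specNorm (weight A t) * specNorm (weight A t)⁻¹

/-- `C = 2 κ (1 + κ ρ)² / (1 - κ ρ)`. -/
def constC (κ ρ : ℝ) : ℝ :=
  2 * (κ * (1 + κ * ρ) ^ 2 / (1 - κ * ρ))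

/-- `D = 2 (3 + κ ρ) / (1 - κ ρ) · max {κ, ‖W⁻¹‖}`, where `w` stands for `‖W⁻¹‖`. -/
def constD (κ ρ w : ℝ) : ℝ :=
  2 * ((3 + κ * ρ) / (1 - κ * ρ)) * max κ w

/-- A sub-isotropic random vector: `E ⟨X, v⟩² ≥ ‖v‖₂²` for all `v`. -/
def IsSubIsotropic {Ω : Type*} [MeasurableSpace Ω] (P : Measure Ω) {d : ℕ}
    (X : Ω → EuclideanSpace ℝ (Fin d)) : Prop :=
  ∀ v : EuclideanSpace ℝ (Fin d), ‖v‖ ^ 2 ≤ ∫ ω, (inner ℝ (X ω) v) ^ 2 ∂P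

/-- A `1`-subgaussian random vector: `E exp (t ⟨X, v⟩) ≤ exp (t²)`, the expectation being finite,
for all `v` with `‖v‖₂² ≤ 1` and all real `t`. -/
def IsOneSubgaussian {Ω : Type*} [MeasurableSpace Ω] (P : Measure Ω) {d : ℕ}
    (X : Ω → EuclideanSpace ℝ (Fin d)) : Prop :=
  ∀ v : EuclideanSpace ℝ (Fin d), ‖v‖ ^ 2 ≤ 1 → ∀ t : ℝ,
    Integrable (fun ω => Real.exp (t * inner ℝ (X ω) v)) P ∧
      ∫ ω, Real.exp (t * inner ℝ (X ω) v) ∂P ≤ Real.exp (t ^ 2)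

/-- The `m × n` matrix with rows `a i + μ 1`. -/
def biasedMatrix {m n : ℕ} (a : Fin m → EuclideanSpace ℝ (Fin n)) (μ : ℝ) :
    Matrix (Fin m) (Fin n) ℝ :=
  Matrix.of fun i j => a i j + μ

/-- The `j`-th column of the `m × n` matrix with rows `a i`. -/
def column {m n : ℕ} (a : Fin m → EuclideanSpace ℝ (Fin n)) (j : Fin n) :
    EuclideanSpace ℝ (Fin m) :=
  WithLp.toLp 2 fun i => a i j

end

end BiasedNNLS

open BiasedNNLS

namespace BiasedNNLS

/-! ### Elementary inequalities for `ℓ_p`-norms -/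

section Norms

/-! The argument has a deterministic and a probabilistic half.

Deterministic half (`NullSpaceProperty.nnls_error_le`). If `d = Aᵀt` is positive, then on
non-negative vectors the weighted norm `‖d x‖₁` is the linear functional `⟨Aᵀt, x⟩ = ⟨t, Ax⟩`. Two
non-negative vectors with close measurements therefore have close weighted `ℓ₁`-norms, so the NNLS
solution behaves like an approximate `ℓ₁`-minimizer without any `ℓ₁`-term. Passing from `v` to `d v`
costs a factor `κ` in the null space constant; as long as `κρ < 1`, the usual null space argument
gives the error bound.

Probabilistic half. Halving the squared difference of two rows removes the bias `μ` and only
decreases the energy `‖Av‖₂²`. The normalized differences over disjoint pairs of rows are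
independent, and again 1-subgaussian and sub-isotropic. The null space property then follows from a
lower bound for `∑ ⟨φ i, v⟩²` on the cone `‖v‖₁² ≤ 4R‖v‖₂²`, `R = s^(2-2/q)/ρ²`
(`nullSpaceProperty_of_lower_bound`).

That bound (`exists_event_sum_inner_sq_ge`) comes from Maurey's empirical method applied to a
quadratic form. For one fixed vector, the lower tail of the sum is exponentially small. A union
bound extends this to all sums of `N` signed unit vectors; counting them as multisets keeps the
entropy near `N log(en/s)`. Averaging over random sums (`quadratic_nonneg_of_multisets`) carries the
bound to every `v`, with a variance loss governed by the column norms and by `‖v‖₁²/N`.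

Finally `Aᵀt` is `1` plus normalized column sums, which subgaussian columns keep within `1/2` of
`1`. This gives `κ < 3` and `‖W⁻¹‖ < 2`. -/

theorem abs_indicator_le {ι : Type*} (S : Set ι) (v : ι → ℝ) (i : ι) : |S.indicator v i| ≤ |v i| := by
  classical
  by_cases h : i ∈ S <;> simp [h]

variable {ι : Type*} [Fintype ι]

theorem ellNorm_nonneg {p : ℝ} (hp : 0 < p) (x : ι → ℝ) : 0 ≤ ellNorm p x := by
  rw [ellNorm_eq_sum hp]; positivity

theorem ellNorm_rpow {p : ℝ} (hp : 0 < p) (x : ι → ℝ) : ellNorm p x ^ p = ∑ i, |x i| ^ p := by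
  rw [ellNorm_eq_sum hp, ← Real.rpow_mul (by positivity), one_div_mul_cancel hp.ne', Real.rpow_one]

theorem ellNorm_one (x : ι → ℝ) : ellNorm 1 x = ∑ i, |x i| := by
  rw [ellNorm_eq_sum one_pos]; simp

theorem ellNorm_two_sq (x : ι → ℝ) : ellNorm 2 x ^ 2 = ∑ i, x i ^ 2 := by
  have := ellNorm_rpow two_pos x
  simpa using this

theorem ellNorm_mono {p : ℝ} (hp : 0 < p) {x y : ι → ℝ} (h : ∀ i, |x i| ≤ |y i|) :
    ellNorm p x ≤ ellNorm p y := by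
  rw [ellNorm_eq_sum hp, ellNorm_eq_sum hp]
  refine Real.rpow_le_rpow (by positivity) (Finset.sum_le_sum fun i _ => ?_) (by positivity)
  exact Real.rpow_le_rpow (abs_nonneg _) (h i) hp.le

theorem ellNorm_add_le {p : ℝ} (hp : 1 ≤ p) (x y : ι → ℝ) :
    ellNorm p (x + y) ≤ ellNorm p x + ellNorm p y := by
  have : Fact (1 ≤ ENNReal.ofReal p) := ⟨by simpa using hp⟩
  unfold ellNorm
  rw [WithLp.toLp_add]
  exact norm_add_le _ _

theorem ellNorm_smul {p : ℝ} (hp : 1 ≤ p) (c : ℝ) (x : ι → ℝ) :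
    ellNorm p (c • x) = |c| * ellNorm p x := by
  have : Fact (1 ≤ ENNReal.ofReal p) := ⟨by simpa using hp⟩
  unfold ellNorm
  rw [WithLp.toLp_smul, norm_smul, Real.norm_eq_abs]

theorem ellNorm_neg {p : ℝ} (hp : 1 ≤ p) (x : ι → ℝ) : ellNorm p (-x) = ellNorm p x := by
  simpa using ellNorm_smul hp (-1) x

theorem ellNorm_le_mul_of_abs_le {p c : ℝ} (hp : 1 ≤ p) (hc : 0 ≤ c) {x y : ι → ℝ}
    (h : ∀ i, |x i| ≤ c * |y i|) : ellNorm p x ≤ c * ellNorm p y := by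
  have : ellNorm p x ≤ ellNorm p (c • y) :=
    ellNorm_mono (by linarith) fun i => by simpa [abs_mul, abs_of_nonneg hc] using h i
  rwa [ellNorm_smul hp, abs_of_nonneg hc] at this

theorem abs_le_ellNorm {p : ℝ} (hp : 0 < p) (x : ι → ℝ) (i : ι) : |x i| ≤ ellNorm p x := by
  have h : |x i| ^ p ≤ ellNorm p x ^ p := by
    rw [ellNorm_rpow hp]
    exact Finset.single_le_sum (f := fun i => |x i| ^ p) (fun i _ => by positivity)
      (Finset.mem_univ i)
  exact (Real.rpow_le_rpow_iff (abs_nonneg _) (ellNorm_nonneg hp x) hp).1 h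

theorem ellNorm_antitone_two {q : ℝ} (hq : 2 ≤ q) (x : ι → ℝ) : ellNorm q x ≤ ellNorm 2 x := by
  have hq0 : 0 < q := by linarith
  have hM := ellNorm_nonneg two_pos x
  rcases hM.eq_or_lt with h0 | h0
  · have hx : ∀ i, |x i| = 0 := fun i =>
      le_antisymm (h0 ▸ abs_le_ellNorm two_pos x i) (abs_nonneg _)
    rw [ellNorm_eq_sum hq0]
    simp [hx, Real.zero_rpow hq0.ne', Real.zero_rpow (inv_pos.2 hq0).ne', hM]
  refine (Real.rpow_le_rpow_iff (ellNorm_nonneg hq0 x) hM hq0).1 ?_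
  rw [ellNorm_rpow hq0]
  calc ∑ i, |x i| ^ q ≤ ∑ i, |x i| ^ (2 : ℝ) * ellNorm 2 x ^ (q - 2) := by
        refine Finset.sum_le_sum fun i _ => ?_
        rcases (abs_nonneg (x i)).eq_or_lt with hx | hx
        · rw [← hx, Real.zero_rpow hq0.ne']; positivity
        · conv_lhs => rw [show q = 2 + (q - 2) by ring, Real.rpow_add hx]
          gcongr
          exact abs_le_ellNorm two_pos x i
    _ = ellNorm 2 x ^ q := by
        rw [← Finset.sum_mul, ← ellNorm_rpow two_pos, ← Real.rpow_add h0]; congr 1; ring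

theorem ellNorm_indicator_eq {p : ℝ} (hp : 0 < p) (S : Finset ι) (v : ι → ℝ) :
    ellNorm p ((S : Set ι).indicator v) = (∑ i ∈ S, |v i| ^ p) ^ (1 / p) := by
  classical
  rw [ellNorm_eq_sum hp, ← Finset.sum_subset (Finset.subset_univ S)]
  · congr 1
    refine Finset.sum_congr rfl fun i hi => ?_
    simp [hi]
  · intro i _ hi
    simp [hi, Real.zero_rpow hp.ne']

/-- Hölder's inequality on at most `s` coordinates, in the form of the power mean inequality with
exponent `q / p`. -/
theorem ellNorm_indicator_le_card {p q : ℝ} (hp : 1 ≤ p) (hpq : p ≤ q) {s : ℕ}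
    (S : Finset ι) (hS : S.card ≤ s) (v : ι → ℝ) :
    ellNorm p ((S : Set ι).indicator v) ≤
      (s : ℝ) ^ (1 / p - 1 / q) * ellNorm q ((S : Set ι).indicator v) := by
  have hp0 : 0 < p := by linarith
  have hq0 : 0 < q := by linarith
  have hr : 1 ≤ q / p := by rw [le_div_iff₀ hp0]; linarith
  have h := Real.rpow_sum_le_const_mul_sum_rpow_of_nonneg S (f := fun i => |v i| ^ p) hr
    (fun i _ => by positivity)
  have h2 : ∀ i, (|v i| ^ p) ^ (q / p) = |v i| ^ q := fun i => by
    rw [← Real.rpow_mul (abs_nonneg _)]; congr 1; field_simp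
  simp only [h2] at h
  rw [ellNorm_indicator_eq hp0, ellNorm_indicator_eq hq0]
  have hA : 0 ≤ ∑ i ∈ S, |v i| ^ p := Finset.sum_nonneg fun i _ => by positivity
  have hB : 0 ≤ ∑ i ∈ S, |v i| ^ q := Finset.sum_nonneg fun i _ => by positivity
  have h3 := Real.rpow_le_rpow (by positivity) h (by positivity : 0 ≤ 1 / q)
  rw [← Real.rpow_mul hA, Real.mul_rpow (by positivity) hB, ← Real.rpow_mul (by positivity)] at h3
  have e1 : q / p * (1 / q) = 1 / p := by field_simp
  have e2 : (q / p - 1) * (1 / q) = 1 / p - 1 / q := by field_simp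
  rw [e1, e2] at h3
  refine h3.trans ?_
  gcongr
  rw [sub_nonneg]
  exact one_div_le_one_div_of_le hp0 hpq

theorem ellNorm_one_split (S : Finset ι) (v : ι → ℝ) :
    ellNorm 1 v = ellNorm 1 ((S : Set ι).indicator v) + ellNorm 1 ((S : Set ι)ᶜ.indicator v) := by
  classical
  simp only [ellNorm_one, ← Finset.sum_add_distrib]
  refine Finset.sum_congr rfl fun i _ => ?_
  by_cases h : i ∈ S <;> simp [h]

theorem ellNorm_le_split {p : ℝ} (hp : 1 ≤ p) (S : Finset ι) (v : ι → ℝ) :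
    ellNorm p v ≤ ellNorm p ((S : Set ι).indicator v) + ellNorm p ((S : Set ι)ᶜ.indicator v) := by
  have := ellNorm_add_le hp ((S : Set ι).indicator v) ((S : Set ι)ᶜ.indicator v)
  rwa [Set.indicator_self_add_compl] at this

/-- A set of `s` coordinates on which `|v|` dominates its values elsewhere. -/
theorem exists_largest_coordinates (v : ι → ℝ) {s : ℕ} (hs : s ≤ Fintype.card ι) :
    ∃ S : Finset ι, S.card = s ∧ ∀ i ∈ S, ∀ j ∉ S, |v j| ≤ |v i| := by
  classical
  induction s with
  | zero => exact ⟨∅, by simp⟩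
  | succ s ih =>
    obtain ⟨S, hS, h⟩ := ih (by omega)
    have hne : (Finset.univ \ S).Nonempty := by
      rw [← Finset.card_pos, Finset.card_sdiff_of_subset (Finset.subset_univ S), Finset.card_univ]
      omega
    obtain ⟨a, ha, hmax⟩ := Finset.exists_max_image _ (fun i => |v i|) hne
    simp only [Finset.mem_sdiff, Finset.mem_univ, true_and] at ha hmax
    refine ⟨insert a S, by simp [ha, hS], fun i hi j hj => ?_⟩
    simp only [Finset.mem_insert, not_or] at hi hj
    rcases hi with rfl | hi
    · exact hmax j hj.2
    · exact h i hi j hj.2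

/-- The Stechkin estimate. -/
theorem ellNorm_compl_largest_le {p : ℝ} (hp : 1 ≤ p) {s : ℕ} (hs : 1 ≤ s) (v : ι → ℝ)
    (S : Finset ι) (hS : S.card = s) (h : ∀ i ∈ S, ∀ j ∉ S, |v j| ≤ |v i|) :
    ellNorm p ((S : Set ι)ᶜ.indicator v) ≤ 1 / (s : ℝ) ^ (1 - 1 / p) * ellNorm 1 v := by
  classical
  have hp0 : 0 < p := by linarith
  have hs0 : (0 : ℝ) < s := by exact_mod_cast hs
  have hN := ellNorm_nonneg one_pos v
  have hsmall : ∀ j ∉ S, |v j| ≤ ellNorm 1 v / s := fun j hj => by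
    rw [le_div_iff₀ hs0]
    calc |v j| * s = ∑ i ∈ S, |v j| := by simp [hS, mul_comm]
      _ ≤ ∑ i ∈ S, |v i| := Finset.sum_le_sum fun i hi => h i hi j hj
      _ ≤ ∑ i, |v i| := Finset.sum_le_univ_sum_of_nonneg fun i => abs_nonneg _
      _ = ellNorm 1 v := (ellNorm_one v).symm
  refine (Real.rpow_le_rpow_iff (ellNorm_nonneg hp0 _) (by positivity) hp0).1 ?_
  have hterm : ∀ i, |(S : Set ι)ᶜ.indicator v i| ^ p ≤ (ellNorm 1 v / s) ^ (p - 1) * |v i| := by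
    intro i
    by_cases hi : i ∈ S
    · simp only [Set.mem_compl_iff, Finset.mem_coe, hi, not_true, not_false_eq_true,
        Set.indicator_of_notMem, abs_zero, Real.zero_rpow hp0.ne']
      positivity
    · have : (S : Set ι)ᶜ.indicator v i = v i := by simp [hi]
      rw [this]
      rcases (abs_nonneg (v i)).eq_or_lt with hx | hx
      · rw [← hx, Real.zero_rpow hp0.ne']; simp
      · calc |v i| ^ p = |v i| ^ (p - 1) * |v i| := by
              conv_lhs => rw [show p = (p - 1) + 1 by ring, Real.rpow_add hx, Real.rpow_one]
          _ ≤ _ := by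
              gcongr
              exact hsmall i hi
  rw [ellNorm_rpow hp0]
  refine (Finset.sum_le_sum fun i _ => hterm i).trans ?_
  rw [← Finset.mul_sum, ← ellNorm_one, Real.mul_rpow (by positivity) hN, one_div,
    Real.inv_rpow (by positivity), ← Real.rpow_mul hs0.le, Real.div_rpow hN hs0.le]
  have e : (1 - 1 / p) * p = p - 1 := by field_simp
  rw [e]
  rcases hN.eq_or_lt with h0 | h0
  · rw [← h0]; simp; positivity
  · have : ellNorm 1 v ^ p = ellNorm 1 v ^ (p - 1) * ellNorm 1 v := by
      conv_lhs => rw [show p = (p - 1) + 1 by ring, Real.rpow_add h0, Real.rpow_one]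
    rw [this]
    apply le_of_eq
    field_simp

end Norms

/-! ### Recovery by NNLS from the null space property -/

section Recovery

variable {m n : ℕ}

theorem ellNorm_compl_support_le (x z : Fin n → ℝ) :
    ellNorm 1 (((Finset.univ.filter fun i => z i ≠ 0 : Finset (Fin n)) : Set (Fin n))ᶜ.indicator x)
      ≤ ellNorm 1 (x - z) := by
  refine ellNorm_mono one_pos fun i => ?_
  by_cases h : z i = 0 <;> simp [h]

/-- The `ℓ_1`-estimate for a pair of vectors under a null space condition on their difference. -/
theorem ellNorm_one_sub_le {S : Finset (Fin n)} {ρ η : ℝ} (hρ1 : ρ < 1)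
    (hρ0 : 0 ≤ ρ) (x z : Fin n → ℝ)
    (h : ellNorm 1 ((S : Set (Fin n)).indicator (z - x)) ≤
      ρ * ellNorm 1 ((S : Set (Fin n))ᶜ.indicator (z - x)) + η) :
    ellNorm 1 (z - x) ≤ (1 + ρ) / (1 - ρ) *
      (ellNorm 1 z - ellNorm 1 x + 2 * ellNorm 1 ((S : Set (Fin n))ᶜ.indicator x))
        + 2 / (1 - ρ) * η := by
  have key : ellNorm 1 ((S : Set (Fin n))ᶜ.indicator (z - x)) ≤
      ellNorm 1 z - ellNorm 1 x + ellNorm 1 ((S : Set (Fin n)).indicator (z - x))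
        + 2 * ellNorm 1 ((S : Set (Fin n))ᶜ.indicator x) := by
    simp only [ellNorm_one, Finset.mul_sum, ← Finset.sum_add_distrib, ← Finset.sum_sub_distrib]
    refine Finset.sum_le_sum fun i _ => ?_
    by_cases hi : i ∈ S
    · simp only [Set.mem_compl_iff, Finset.mem_coe, hi, not_true, not_false_eq_true,
        Set.indicator_of_notMem, Set.indicator_of_mem, abs_zero, Pi.sub_apply]
      have := abs_sub_abs_le_abs_sub (x i) (z i)
      rw [abs_sub_comm] at this
      linarith
    · simp only [Set.mem_compl_iff, Finset.mem_coe, hi, not_false_eq_true,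
        Set.indicator_of_notMem, Set.indicator_of_mem, abs_zero, Pi.sub_apply]
      have := abs_sub (z i) (x i)
      linarith
  have hsplit := ellNorm_one_split S (z - x)
  have h1 : 0 < 1 - ρ := by linarith
  set a := ellNorm 1 ((S : Set (Fin n)).indicator (z - x))
  set b := ellNorm 1 ((S : Set (Fin n))ᶜ.indicator (z - x))
  set d := ellNorm 1 z - ellNorm 1 x
  set e := ellNorm 1 ((S : Set (Fin n))ᶜ.indicator x)
  have hb : b * (1 - ρ) ≤ d + 2 * e + η := by nlinarith
  rw [hsplit, div_mul_eq_mul_div, div_mul_eq_mul_div, ← add_div, le_div_iff₀ h1]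
  nlinarith

/-- Here `w` and `w'` stand for `‖W‖` and `‖W⁻¹‖`: weighting the left side costs `w`, unweighting
the tail on the right costs `w'`, so `ρ` becomes `κρ`. -/
theorem nullSpaceProperty_diagonal {A : Matrix (Fin m) (Fin n) ℝ} {q ρ τ : ℝ} {s : ℕ}
    (hq : 1 ≤ q) (hρ : 0 ≤ ρ) (hA : NullSpaceProperty A q s ρ τ) {d : Fin n → ℝ}
    {w w' : ℝ} (hw : 0 ≤ w) (hw' : 0 ≤ w') (hd : ∀ i, |d i| ≤ w)
    (hd' : ∀ i, 1 ≤ w' * |d i|) (v : Fin n → ℝ) (S : Finset (Fin n)) (hS : S.card ≤ s) :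
    ellNorm q ((S : Set (Fin n)).indicator (d * v)) ≤
      (w * w' * ρ) / (s : ℝ) ^ (1 - 1 / q) * ellNorm 1 ((S : Set (Fin n))ᶜ.indicator (d * v))
        + w * τ * ellNorm 2 (A.mulVec v) := by
  have h1 : ellNorm q ((S : Set (Fin n)).indicator (d * v)) ≤
      w * ellNorm q ((S : Set (Fin n)).indicator v) := by
    refine ellNorm_le_mul_of_abs_le hq hw fun i => ?_
    by_cases hi : i ∈ S
    · simpa [hi, abs_mul] using mul_le_mul_of_nonneg_right (hd i) (abs_nonneg (v i))
    · simp [hi]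
  have h2 : ellNorm 1 ((S : Set (Fin n))ᶜ.indicator v) ≤
      w' * ellNorm 1 ((S : Set (Fin n))ᶜ.indicator (d * v)) := by
    refine ellNorm_le_mul_of_abs_le le_rfl hw' fun i => ?_
    by_cases hi : i ∈ S
    · simp [hi]
    · simpa [hi, abs_mul, mul_assoc] using mul_le_mul_of_nonneg_right (hd' i) (abs_nonneg (v i))
  have h3 := hA v S hS
  calc _ ≤ _ := h1
    _ ≤ w * (ρ / (s : ℝ) ^ (1 - 1 / q) * ellNorm 1 ((S : Set (Fin n))ᶜ.indicator v)
        + τ * ellNorm 2 (A.mulVec v)) := by gcongr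
    _ ≤ w * (ρ / (s : ℝ) ^ (1 - 1 / q) * (w' * ellNorm 1 ((S : Set (Fin n))ᶜ.indicator (d * v)))
        + τ * ellNorm 2 (A.mulVec v)) := by gcongr
    _ = _ := by ring

/-- A null space condition of order `s` controls the `ℓ_p`-norm by the `ℓ_1`-norm. -/
theorem ellNorm_le_of_nullSpace {p q ρ η : ℝ} (hp : 1 ≤ p) (hpq : p ≤ q) (hρ : 0 ≤ ρ) {s : ℕ}
    (hs : 1 ≤ s) (hsn : s ≤ n) (v : Fin n → ℝ)
    (h : ∀ S : Finset (Fin n), S.card ≤ s → ellNorm q ((S : Set (Fin n)).indicator v) ≤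
      ρ / (s : ℝ) ^ (1 - 1 / q) * ellNorm 1 ((S : Set (Fin n))ᶜ.indicator v) + η) :
    ellNorm p v ≤ (1 + ρ) / (s : ℝ) ^ (1 - 1 / p) * ellNorm 1 v
      + (s : ℝ) ^ (1 / p - 1 / q) * η := by
  have hs0 : (0 : ℝ) < s := by exact_mod_cast hs
  -- With the largest coordinates in `S`, the null space condition bounds the part on `S` and
  -- Stechkin's estimate bounds the rest.
  obtain ⟨S, hS, hmax⟩ := exists_largest_coordinates v (s := s) (by simpa using hsn)
  have h1 := ellNorm_le_split hp S v
  have h2 := ellNorm_compl_largest_le hp hs v S hS hmax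
  have h3 := ellNorm_indicator_le_card hp hpq S hS.le v
  have h4 := h S hS.le
  have h5 : ellNorm 1 ((S : Set (Fin n))ᶜ.indicator v) ≤ ellNorm 1 v :=
    ellNorm_mono one_pos (abs_indicator_le _ v)
  have e : (s : ℝ) ^ (1 / p - 1 / q) * (ρ / (s : ℝ) ^ (1 - 1 / q)) = ρ / (s : ℝ) ^ (1 - 1 / p) := by
    rw [mul_div_left_comm, ← Real.rpow_sub hs0, div_eq_mul_inv ρ, ← Real.rpow_neg hs0.le]
    congr 2; ring
  calc ellNorm p v ≤ (s : ℝ) ^ (1 / p - 1 / q) *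
        (ρ / (s : ℝ) ^ (1 - 1 / q) * ellNorm 1 v + η) + 1 / (s : ℝ) ^ (1 - 1 / p) * ellNorm 1 v := by
        refine h1.trans (add_le_add (h3.trans ?_) h2)
        gcongr
        refine h4.trans ?_
        gcongr
    _ = _ := by rw [mul_add, ← mul_assoc, e]; ring

theorem ellNorm_one_of_nonneg {x d : Fin n → ℝ} (hx : ∀ i, 0 ≤ x i) (hd : ∀ i, 0 ≤ d i) :
    ellNorm 1 (d * x) = ∑ i, d i * x i := by
  rw [ellNorm_one]
  exact Finset.sum_congr rfl fun i _ => abs_of_nonneg (mul_nonneg (hd i) (hx i))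

/-- For non-negative vectors the weighted `ℓ_1`-norm is controlled by the measurements. -/
theorem weighted_ellNorm_one_sub_le (A : Matrix (Fin m) (Fin n) ℝ) (t : Fin m → ℝ)
    (hd : ∀ j, 0 ≤ A.transpose.mulVec t j) {x z : Fin n → ℝ} (hx : ∀ i, 0 ≤ x i)
    (hz : ∀ i, 0 ≤ z i) :
    ellNorm 1 (A.transpose.mulVec t * z) - ellNorm 1 (A.transpose.mulVec t * x) ≤
      ellNorm 2 t * ellNorm 2 (A.mulVec (z - x)) := by
  rw [ellNorm_one_of_nonneg hz hd, ellNorm_one_of_nonneg hx hd, ← Finset.sum_sub_distrib]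
  -- Adjointness: `⟨Aᵀt, z - x⟩ = ⟨t, A(z - x)⟩`, after which Cauchy–Schwarz applies.
  have h : ∑ i, (A.transpose.mulVec t i * z i - A.transpose.mulVec t i * x i) =
      ∑ i, t i * A.mulVec (z - x) i := by
    have := Matrix.dotProduct_mulVec t A (z - x)
    rw [← Matrix.mulVec_transpose] at this
    simp only [dotProduct, Pi.sub_apply] at this
    rw [this]
    exact Finset.sum_congr rfl fun i _ => by ring
  rw [h]
  refine le_of_sq_le_sq ?_ (mul_nonneg (ellNorm_nonneg two_pos _) (ellNorm_nonneg two_pos _))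
  rw [mul_pow, ellNorm_two_sq, ellNorm_two_sq]
  exact Finset.sum_mul_sq_le_sq_mul_sq _ _ _

/-- The vector `x₀` is feasible with residual `z`, so the minimizer has residual at most `‖z‖₂`;
this is the source of the factor `2` in `constD`. -/
theorem IsNNLSSolution.mulVec_sub_le {A : Matrix (Fin m) (Fin n) ℝ} {x₀ x : Fin n → ℝ}
    {z : Fin m → ℝ} (hx₀ : ∀ i, 0 ≤ x₀ i) (h : IsNNLSSolution A (A.mulVec x₀ + z) x) :
    ellNorm 2 (A.mulVec (x - x₀)) ≤ 2 * ellNorm 2 z := by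
  have h1 := h.2 x₀ hx₀
  rw [add_sub_cancel_left] at h1
  have h2 : A.mulVec (x - x₀) = -(A.mulVec x₀ + z - A.mulVec x) + z := by
    rw [Matrix.mulVec_sub]; abel
  rw [h2]
  have := ellNorm_add_le one_le_two (-(A.mulVec x₀ + z - A.mulVec x)) z
  rw [ellNorm_neg one_le_two] at this
  linarith

/-- Recovery of non-negative vectors by the NNLS under the null space property. -/
theorem NullSpaceProperty.nnls_error_le {A : Matrix (Fin m) (Fin n) ℝ} {q ρ τ : ℝ} {s : ℕ}
    (hq : 1 ≤ q) (hρ : 0 ≤ ρ) (hτ : 0 ≤ τ) (hs : 1 ≤ s) (hsn : s ≤ n)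
    (hA : NullSpaceProperty A q s ρ τ) (t : Fin m → ℝ)
    (hd : ∀ j, 0 < A.transpose.mulVec t j) {w w' : ℝ} (hw : 0 ≤ w) (hw' : 0 ≤ w')
    (hdw : ∀ j, A.transpose.mulVec t j ≤ w) (hdw' : ∀ j, 1 ≤ w' * A.transpose.mulVec t j)
    (hκ : w * w' * ρ < 1) {p : ℝ} (hp : 1 ≤ p) (hpq : p ≤ q) {x₀ : Fin n → ℝ}
    (hx₀ : ∀ i, 0 ≤ x₀ i) {z : Fin m → ℝ} {x : Fin n → ℝ}
    (hx : IsNNLSSolution A (A.mulVec x₀ + z) x) :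
    ellNorm p (x - x₀) ≤
      constC (w * w') ρ / (s : ℝ) ^ (1 - 1 / p) * bestApproxError s 1 x₀
        + constD (w * w') ρ w' / (s : ℝ) ^ (1 / q - 1 / p) * (ellNorm 2 t + τ) * ellNorm 2 z := by
  set d := A.transpose.mulVec t with hddef
  have hs0 : (0 : ℝ) < s := by exact_mod_cast hs
  have hs1 : (1 : ℝ) ≤ s := by exact_mod_cast hs
  have hp0 : 0 < p := by linarith
  have hq0 : 0 < q := by linarith
  set r := w * w' * ρ with hr
  have hr0 : 0 ≤ r := by positivity
  set ε := ellNorm 2 (A.mulVec (x - x₀)) with hε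
  have hε0 : 0 ≤ ε := ellNorm_nonneg two_pos _
  have hεz : ε ≤ 2 * ellNorm 2 z := hx.mulVec_sub_le hx₀
  have habs : ∀ j, |d j| = d j := fun j => abs_of_pos (hd j)
  have hnsp : ∀ S : Finset (Fin n), S.card ≤ s →
      ellNorm q ((S : Set (Fin n)).indicator (d * (x - x₀))) ≤
      r / (s : ℝ) ^ (1 - 1 / q) * ellNorm 1 ((S : Set (Fin n))ᶜ.indicator (d * (x - x₀)))
        + w * τ * ε := fun S hS =>
    nullSpaceProperty_diagonal hq hρ hA hw hw' (fun i => by rw [habs]; exact hdw i)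
      (fun i => by rw [habs]; exact hdw' i) (x - x₀) S hS
  have ht0 : 0 ≤ ellNorm 2 t := ellNorm_nonneg two_pos _
  have hwt := weighted_ellNorm_one_sub_le A t (fun j => (hd j).le) hx₀ hx.1
  -- the estimate for a fixed sparse approximation of `x₀`
  have main : ∀ y : {y : Fin n → ℝ // (Finset.univ.filter fun i => y i ≠ 0).card ≤ s},
      ellNorm 1 (d * (x - x₀)) ≤ (1 + r) / (1 - r) *
        (ellNorm 2 t * ε + 2 * (w * ellNorm 1 (x₀ - y.1)))
        + 2 / (1 - r) * ((s : ℝ) ^ (1 - 1 / q) * (w * τ * ε)) := by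
    rintro ⟨y, hy⟩
    set S := Finset.univ.filter fun i => y i ≠ 0 with hSdef
    have h1 := ellNorm_indicator_le_card le_rfl hq S hy (d * (x - x₀))
    have h2 : ellNorm 1 ((S : Set (Fin n)).indicator (d * (x - x₀))) ≤
        r * ellNorm 1 ((S : Set (Fin n))ᶜ.indicator (d * (x - x₀)))
          + (s : ℝ) ^ (1 - 1 / q) * (w * τ * ε) := by
      refine h1.trans ((mul_le_mul_of_nonneg_left (hnsp S hy) (by positivity)).trans ?_)
      rw [mul_add, ← mul_assoc, one_div_one]
      gcongr
      · exact ellNorm_nonneg one_pos _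
      · rw [mul_div_cancel₀]; positivity
    rw [mul_sub] at h2 ⊢
    refine (ellNorm_one_sub_le hκ hr0 _ _ h2).trans ?_
    have h3 : ellNorm 1 ((S : Set (Fin n))ᶜ.indicator (d * x₀)) ≤ w * ellNorm 1 (x₀ - y) := by
      refine le_trans ?_ (mul_le_mul_of_nonneg_left (ellNorm_compl_support_le x₀ y) hw)
      refine ellNorm_le_mul_of_abs_le le_rfl hw fun i => ?_
      by_cases hi : i ∈ S
      · simp [S] at hi; simp [S, hi]
      · have hi' : y i = 0 := by simpa [S] using hi
        have := mul_le_mul_of_nonneg_right (hdw i) (abs_nonneg (x₀ i))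
        simpa [S, hi', abs_mul, habs] using this
    have h1r : 0 < 1 - r := by linarith
    gcongr
  have hσ : ellNorm 1 (d * (x - x₀)) ≤ (1 + r) / (1 - r) *
        (ellNorm 2 t * ε + 2 * (w * bestApproxError s 1 x₀))
        + 2 / (1 - r) * ((s : ℝ) ^ (1 - 1 / q) * (w * τ * ε)) := by
    have h1r : 0 < 1 - r := by linarith
    have : Nonempty {y : Fin n → ℝ // (Finset.univ.filter fun i => y i ≠ 0).card ≤ s} :=
      ⟨⟨0, by simp⟩⟩
    -- Passing to the infimum divides by a multiple of `w`, so `w = 0` is treated apart; there the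
    -- approximation term vanishes.
    rcases hw.eq_or_lt with h0 | h0
    · have := main (Classical.arbitrary _)
      rw [← h0] at this ⊢
      simpa using this
    set c := (1 + r) / (1 - r) * (2 * w) with hc
    have hc0 : 0 < c := by positivity
    have : (ellNorm 1 (d * (x - x₀)) - (1 + r) / (1 - r) * (ellNorm 2 t * ε)
        - 2 / (1 - r) * ((s : ℝ) ^ (1 - 1 / q) * (w * τ * ε))) / c ≤ bestApproxError s 1 x₀ := by
      refine le_ciInf fun y => ?_
      rw [div_le_iff₀ hc0]
      have := main y
      rw [hc]; linarith
    rw [div_le_iff₀ hc0, hc] at this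
    linarith
  have hfin := ellNorm_le_of_nullSpace hp hpq hr0 hs hsn _ hnsp
  have hun : ellNorm p (x - x₀) ≤ w' * ellNorm p (d * (x - x₀)) := by
    refine ellNorm_le_mul_of_abs_le hp hw' fun i => ?_
    have := mul_le_mul_of_nonneg_right (hdw' i) (abs_nonneg ((x - x₀) i))
    rw [Pi.mul_apply, abs_mul, habs]; linarith
  have h1r : 0 < 1 - r := by linarith
  have hσ0 : 0 ≤ bestApproxError s 1 x₀ := Real.iInf_nonneg fun y => ellNorm_nonneg one_pos _
  set a := (s : ℝ) ^ (1 - 1 / p) with ha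
  set b := (s : ℝ) ^ (1 / q - 1 / p) with hb
  have ha0 : 0 < a := by positivity
  have hb0 : 0 < b := by positivity
  have hab : b ≤ a := by
    apply Real.rpow_le_rpow_of_exponent_le hs1
    have : 1 / q ≤ 1 := by rw [div_le_one hq0]; exact hq
    linarith
  have hs2 : (s : ℝ) ^ (1 / p - 1 / q) = 1 / b := by
    rw [hb, one_div (_ ^ _), ← Real.rpow_neg hs0.le]; congr 1; ring
  have hs3 : (s : ℝ) ^ (1 - 1 / q) = a / b := by
    rw [ha, hb, ← Real.rpow_sub hs0]; congr 1; ring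
  rw [hs2] at hfin
  rw [hs3] at hσ
  set σ := bestApproxError s 1 x₀
  set T := ellNorm 2 t
  set ζ := ellNorm 2 z
  have hstep : ellNorm p (x - x₀) ≤ w' * ((1 + r) / a * ((1 + r) / (1 - r) *
      (T * ε + 2 * (w * σ)) + 2 / (1 - r) * (a / b * (w * τ * ε))) + 1 / b * (w * τ * ε)) := by
    refine hun.trans ?_
    gcongr
    refine hfin.trans ?_
    gcongr
  refine hstep.trans ?_
  have hκr : w * w' * ρ = r := rfl
  unfold constC constD
  rw [hκr]
  have e1 : w' * ((1 + r) / a * ((1 + r) / (1 - r) *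
      (T * ε + 2 * (w * σ)) + 2 / (1 - r) * (a / b * (w * τ * ε))) + 1 / b * (w * τ * ε)) =
      2 * (w * w' * (1 + r) ^ 2 / (1 - r)) / a * σ +
      (w' * ((1 + r) ^ 2 / (1 - r) / a * T) + (3 + r) / (1 - r) / b * (w * w') * τ) * ε := by
    field_simp
    ring
  rw [e1]
  refine add_le_add le_rfl ?_
  -- Since `0 ≤ r < 1`, one has `r + r² ≤ 2`; together with `b ≤ a` this lets both noise terms share
  -- one coefficient.
  have e2 : (1 + r) ^ 2 / (1 - r) / a ≤ (3 + r) / (1 - r) / b := by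
    have : (1 + r) ^ 2 ≤ 3 + r := by nlinarith
    gcongr
  have e3 : w' * ((1 + r) ^ 2 / (1 - r) / a * T) + (3 + r) / (1 - r) / b * (w * w') * τ ≤
      (3 + r) / (1 - r) / b * max (w * w') w' * (T + τ) := by
    have hD : 0 ≤ (3 + r) / (1 - r) / b := by positivity
    calc _ ≤ max (w * w') w' * ((3 + r) / (1 - r) / b * T)
          + (3 + r) / (1 - r) / b * max (w * w') w' * τ := by
          gcongr
          · exact le_max_right _ _
          · exact le_max_left _ _
      _ = _ := by ring
  calc _ ≤ ((3 + r) / (1 - r) / b * max (w * w') w' * (T + τ)) * (2 * ζ) := by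
        gcongr
    _ = _ := by ring

theorem specNorm_diagonal (d : Fin n → ℝ) : specNorm (Matrix.diagonal d) = ‖d‖ := by
  open scoped Matrix.Norms.L2Operator in
  unfold specNorm
  rw [Matrix.l2_opNorm_toEuclideanCLM, Matrix.l2_opNorm_diagonal]

end Recovery

/-! ### Tails of sums of squares of subgaussian variables -/

section OneDimensional

variable {Ω : Type*} [MeasurableSpace Ω] {P : Measure Ω}

/-- Truncation at `75/8` with an exponentially integrable remainder: `exp (2y - 7) ≥ (y - 5/2)²` for
large `y`, and `3(y - 5/2)² - y² + 75/8 = 2(y - 15/4)²` is a perfect square. -/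
theorem sq_le_add_exp (x : ℝ) :
    x ^ 2 ≤ min (x ^ 2) (75 / 8) + 3 * Real.exp (-7) * (Real.exp (2 * x) + Real.exp (-2 * x)) := by
  have key : ∀ y : ℝ, 0 ≤ y →
      y ^ 2 ≤ min (y ^ 2) (75 / 8) + 3 * Real.exp (-7) * Real.exp (2 * y) := by
    intro y hy
    rcases le_total (y ^ 2) (75 / 8) with h | h
    · rw [min_eq_left h]
      nlinarith [mul_pos (Real.exp_pos (-7)) (Real.exp_pos (2 * y))]
    · rw [min_eq_right h, mul_assoc, ← Real.exp_add]
      have h1 : y - 5 / 2 ≤ Real.exp (y - 7 / 2) := by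
        have := Real.add_one_le_exp (y - 7 / 2); linarith
      have h2 : 0 ≤ y - 5 / 2 := by nlinarith
      have h3 : Real.exp (-7 + 2 * y) = Real.exp (y - 7 / 2) ^ 2 := by
        rw [← Real.exp_nat_mul]; congr 1; push_cast; ring
      rw [h3]
      nlinarith [sq_nonneg (y - 15 / 4), pow_le_pow_left₀ h2 h1 2]
  have hpos : ∀ z, 0 ≤ 3 * Real.exp (-7) * Real.exp z := fun z => by positivity
  rcases le_total 0 x with hx | hx
  · have := key x hx
    have := hpos (-2 * x)
    linarith
  · have h1 := key (-x) (by linarith)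
    have := hpos (2 * x)
    rw [neg_sq, show 2 * -x = -2 * x by ring] at h1
    linarith

/-- Below the truncation level the exponent runs over `[-4, 0]`, and convexity puts `exp` under its
chord; `196/1875` is `8/75 · (1 - 1/50)`, with `exp (-4) ≤ 1/50`. Above the level the right side
equals `1/50`. -/
theorem exp_neg_mul_sq_le (x : ℝ) :
    Real.exp (-(32 / 75) * x ^ 2) ≤ 1 - 196 / 1875 * min (x ^ 2) (75 / 8) := by
  have e4 : Real.exp (-4) ≤ 1 / 50 := by
    have h := Real.exp_one_gt_d9
    have h4 : Real.exp 4 = Real.exp 1 ^ 4 := by rw [← Real.exp_nat_mul]; norm_num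
    rw [Real.exp_neg, h4, one_div]
    apply inv_anti₀ (by norm_num)
    calc (50 : ℝ) ≤ 2.7 ^ 4 := by norm_num
      _ ≤ _ := by gcongr; linarith
  rcases le_total (x ^ 2) (75 / 8) with h | h
  · rw [min_eq_left h]
    have hc := (convexOn_exp).2 (Set.mem_univ (0 : ℝ)) (Set.mem_univ (-4 : ℝ))
      (sub_nonneg.2 (by linarith : 8 / 75 * x ^ 2 ≤ 1)) (by positivity : 0 ≤ 8 / 75 * x ^ 2)
      (by ring)
    simp only [smul_eq_mul, mul_zero, zero_add, Real.exp_zero, mul_one] at hc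
    rw [show -(32 / 75) * x ^ 2 = 8 / 75 * x ^ 2 * -4 by ring]
    nlinarith [sq_nonneg x]
  · rw [min_eq_right h]
    have : Real.exp (-(32 / 75) * x ^ 2) ≤ Real.exp (-4) := by
      apply Real.exp_le_exp.2; linarith
    linarith

theorem integrable_exp_neg_mul_sq_comp [IsProbabilityMeasure P] {X : Ω → ℝ} {c : ℝ} (hc : 0 ≤ c)
    (hX : AEMeasurable X P) : Integrable (fun ω => Real.exp (-c * X ω ^ 2)) P := by
  refine Integrable.of_bound (C := 1) ?_ ?_
  · exact (Real.measurable_exp.comp_aemeasurable ((hX.pow_const 2).const_mul _)).aestronglyMeasurable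
  · refine Filter.Eventually.of_forall fun ω => ?_
    rw [Real.norm_eq_abs, abs_of_pos (Real.exp_pos _), Real.exp_le_one_iff]
    nlinarith [sq_nonneg (X ω)]

/-- A Laplace transform bound for the square of a subgaussian variable of variance at least `1`. -/
theorem integral_exp_neg_sq_le [IsProbabilityMeasure P] {X : Ω → ℝ}
    (hX : HasSubgaussianMGF X 2 P) (hvar : 1 ≤ ∫ ω, X ω ^ 2 ∂P) :
    mgf (fun ω => X ω ^ 2) P (-(32 / 75)) ≤ Real.exp (-(73 / 1000)) := by
  have hmin : Integrable (fun ω => min (X ω ^ 2) (75 / 8 : ℝ)) P := by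
    refine Integrable.of_bound (C := 75 / 8) ?_ ?_
    · exact ((hX.aemeasurable.pow_const 2).min aemeasurable_const).aestronglyMeasurable
    · refine Filter.Eventually.of_forall fun ω => ?_
      rw [Real.norm_eq_abs, abs_of_nonneg (le_min (sq_nonneg _) (by norm_num))]
      exact min_le_right _ _
  have hi1 := hX.integrable_exp_mul 2
  have hi2 := hX.integrable_exp_mul (-2)
  have hsq : Integrable (fun ω => X ω ^ 2) P := (hX.memLp 2).integrable_sq
  have hm1 := hX.mgf_le 2
  have hm2 := hX.mgf_le (-2)
  unfold mgf at hm1 hm2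
  norm_num at hm1 hm2
  have h1 : 1 ≤ ∫ ω, min (X ω ^ 2) (75 / 8 : ℝ) ∂P + 3 * Real.exp (-7) *
      (∫ ω, Real.exp (2 * X ω) ∂P + ∫ ω, Real.exp (-2 * X ω) ∂P) := by
    rw [← integral_add hi1 hi2, ← integral_const_mul, ← integral_add hmin]
    · refine hvar.trans (integral_mono hsq ?_ fun ω => sq_le_add_exp (X ω))
      exact hmin.add ((hi1.add hi2).const_mul _)
    · exact (hi1.add hi2).const_mul _
  -- Both exponential moments are at most `exp 4`, so the remainder is at most `6 exp (-3) ≤ 3/10`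
  -- and the truncated second moment keeps at least `7/10`.
  have h2 : 3 * Real.exp (-7) * (∫ ω, Real.exp (2 * X ω) ∂P + ∫ ω, Real.exp (-2 * X ω) ∂P)
      ≤ 3 / 10 := by
    have e3 : Real.exp (-7) * Real.exp 4 ≤ 1 / 20 := by
      rw [← Real.exp_add, show (-7 + 4 : ℝ) = -3 by norm_num, Real.exp_neg, one_div]
      have h := Real.exp_one_gt_d9
      have h3 : Real.exp 3 = Real.exp 1 ^ 3 := by rw [← Real.exp_nat_mul]; norm_num
      rw [h3]
      apply inv_anti₀ (by norm_num)
      calc (20 : ℝ) ≤ 2.718 ^ 3 := by norm_num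
        _ ≤ _ := by gcongr; linarith
    simp only [neg_mul]
    have := Real.exp_pos (-7)
    nlinarith
  have h3 : mgf (fun ω => X ω ^ 2) P (-(32 / 75)) ≤
      ∫ ω, (1 - 196 / 1875 * min (X ω ^ 2) (75 / 8 : ℝ)) ∂P :=
    integral_mono (integrable_exp_neg_mul_sq_comp (by norm_num) hX.aemeasurable)
      ((integrable_const _).sub (hmin.const_mul _)) fun ω => exp_neg_mul_sq_le (X ω)
  rw [integral_sub (integrable_const _) (hmin.const_mul _), integral_const_mul] at h3
  simp only [integral_const, probReal_univ, smul_eq_mul, mul_one] at h3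
  have := Real.add_one_le_exp (-(73 / 1000) : ℝ)
  linarith

/-- The integral is `√2`, and `1 + 2/5 + (2/5)²/2 = 1.48` already exceeds it. -/
theorem integral_gaussian_exp_sq :
    ∫⁻ g, ENNReal.ofReal (Real.exp (g ^ 2 / 4)) ∂(gaussianReal 0 1) ≤
      ENNReal.ofReal (Real.exp (2 / 5)) := by
  have heq : ∀ x, gaussianPDFReal 0 1 x * Real.exp (x ^ 2 / 4) =
      (√(2 * Real.pi))⁻¹ * Real.exp (-(1 / 4) * x ^ 2) := fun x => by
    simp only [gaussianPDFReal, NNReal.coe_one, mul_one, sub_zero]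
    rw [mul_assoc, ← Real.exp_add]; congr 2; ring
  rw [gaussianReal_of_var_ne_zero 0 one_ne_zero,
    lintegral_withDensity_eq_lintegral_mul _ (measurable_gaussianPDF 0 1) (by fun_prop)]
  have h1 : ∀ x, (gaussianPDF 0 1 * fun g => ENNReal.ofReal (Real.exp (g ^ 2 / 4))) x =
      ENNReal.ofReal ((√(2 * Real.pi))⁻¹ * Real.exp (-(1 / 4) * x ^ 2)) := fun x => by
    rw [← heq, Pi.mul_apply, gaussianPDF, ENNReal.ofReal_mul (gaussianPDFReal_nonneg _ _ _)]
  simp_rw [h1]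
  rw [← ofReal_integral_eq_lintegral_ofReal]
  · apply ENNReal.ofReal_le_ofReal
    rw [integral_const_mul, integral_gaussian]
    have h2 : √(Real.pi / (1 / 4)) = √2 * √(2 * Real.pi) := by
      rw [← Real.sqrt_mul (by norm_num)]; congr 1; ring
    have h3 : 0 < √(2 * Real.pi) := Real.sqrt_pos.2 (by positivity)
    rw [h2, mul_comm √2, inv_mul_cancel_left₀ h3.ne']
    have h4 := Real.quadratic_le_exp_of_nonneg (x := 2 / 5) (by norm_num)
    refine le_trans ?_ h4
    rw [Real.sqrt_le_left (by norm_num)]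
    norm_num
  · exact (integrable_exp_neg_mul_sq (by norm_num)).const_mul _
  · exact Filter.Eventually.of_forall fun x => by positivity

/-- The square of a subgaussian variable has an exponential moment. -/
theorem lintegral_exp_sq_le [IsProbabilityMeasure P] {X : Ω → ℝ} (hm : Measurable X)
    (hX : HasSubgaussianMGF X 2 P) :
    ∫⁻ ω, ENNReal.ofReal (Real.exp (1 / 8 * X ω ^ 2)) ∂P ≤ ENNReal.ofReal (Real.exp (2 / 5)) := by
  -- Gaussian linearization: `exp (X²/8)` is the mean of `exp (X g / 2)` over a standard Gaussian
  -- `g`. After swapping the integrals, the subgaussian bound leaves `exp (g²/4)`.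
  have h1 : ∀ ω, ENNReal.ofReal (Real.exp (1 / 8 * X ω ^ 2)) =
      ∫⁻ g, ENNReal.ofReal (Real.exp (X ω / 2 * g)) ∂(gaussianReal 0 1) := fun ω => by
    rw [← ofReal_integral_eq_lintegral_ofReal (integrable_exp_mul_gaussianReal _)
      (Filter.Eventually.of_forall fun x => (Real.exp_pos _).le)]
    have := congrFun (mgf_fun_id_gaussianReal (μ := 0) (v := 1)) (X ω / 2)
    unfold mgf at this
    rw [this]
    congr 2
    simp
    ring
  simp_rw [h1]
  rw [lintegral_lintegral_swap (by fun_prop)]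
  refine le_trans (lintegral_mono fun g => ?_) integral_gaussian_exp_sq
  have h2 : ∀ ω, X ω / 2 * g = g / 2 * X ω := fun ω => by ring
  simp_rw [h2]
  rw [← ofReal_integral_eq_lintegral_ofReal (hX.integrable_exp_mul _)
      (Filter.Eventually.of_forall fun x => (Real.exp_pos _).le)]
  apply ENNReal.ofReal_le_ofReal
  refine (hX.mgf_le (g / 2)).trans (le_of_eq ?_)
  congr 1
  simp
  ring

theorem integrable_exp_sq [IsProbabilityMeasure P] {X : Ω → ℝ} (hm : Measurable X)
    (hX : HasSubgaussianMGF X 2 P) : Integrable (fun ω => Real.exp (1 / 8 * X ω ^ 2)) P := by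
  refine ⟨by fun_prop, ?_⟩
  rw [hasFiniteIntegral_iff_ofReal (Filter.Eventually.of_forall fun ω => (Real.exp_pos _).le)]
  exact (lintegral_exp_sq_le hm hX).trans_lt ENNReal.ofReal_lt_top

theorem mgf_sq_le [IsProbabilityMeasure P] {X : Ω → ℝ} (hm : Measurable X)
    (hX : HasSubgaussianMGF X 2 P) : mgf (fun ω => X ω ^ 2) P (1 / 8) ≤ Real.exp (2 / 5) := by
  unfold mgf
  rw [integral_eq_lintegral_of_nonneg_ae
    (Filter.Eventually.of_forall fun ω => (Real.exp_pos _).le) (by fun_prop)]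
  exact ENNReal.toReal_le_of_le_ofReal (Real.exp_pos _).le (lintegral_exp_sq_le hm hX)

variable {k : ℕ} {X : Fin k → Ω → ℝ}

/-- Chernoff's method at parameter `-32/75`: the exponent per summand is `(32/75)/50 - 73/1000 <
-3/50`. -/
theorem measure_sum_sq_le_le [IsProbabilityMeasure P] (hind : iIndepFun X P)
    (hm : ∀ i, Measurable (X i)) (hX : ∀ i, HasSubgaussianMGF (X i) 2 P)
    (hvar : ∀ i, 1 ≤ ∫ ω, X i ω ^ 2 ∂P) :
    P.real {ω | ∑ i, X i ω ^ 2 ≤ (k : ℝ) / 50} ≤ Real.exp (-(3 / 50) * k) := by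
  have hind2 : iIndepFun (fun i ω => X i ω ^ 2) P :=
    hind.comp (fun _ x => x ^ 2) fun _ => by fun_prop
  have hm2 : ∀ i, Measurable fun ω => X i ω ^ 2 := fun i => by fun_prop
  have hint := hind2.integrable_exp_mul_sum (t := -(32 / 75)) hm2 (s := Finset.univ)
    fun i _ => integrable_exp_neg_mul_sq_comp (by norm_num) (hm i).aemeasurable
  have h := measure_le_le_exp_mul_mgf ((k : ℝ) / 50) (by norm_num) hint
  rw [hind2.mgf_sum hm2] at h
  simp only [Finset.sum_apply] at h
  refine h.trans ?_
  have hprod : ∏ i, mgf (fun ω => X i ω ^ 2) P (-(32 / 75)) ≤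
      ∏ _i : Fin k, Real.exp (-(73 / 1000)) :=
    Finset.prod_le_prod (fun i _ => mgf_nonneg) fun i _ => integral_exp_neg_sq_le (hX i) (hvar i)
  rw [Finset.prod_const, Finset.card_univ, Fintype.card_fin, ← Real.exp_nat_mul] at hprod
  refine (mul_le_mul_of_nonneg_left hprod (Real.exp_pos _).le).trans ?_
  rw [← Real.exp_add]
  apply Real.exp_le_exp.2
  have : (0 : ℝ) ≤ k := by positivity
  linarith

/-- Chernoff's method at parameter `1/8`: the exponent per summand is `2/5 - 4/8 = -1/10`. -/
theorem measure_le_sum_sq_le [IsProbabilityMeasure P] (hind : iIndepFun X P)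
    (hm : ∀ i, Measurable (X i)) (hX : ∀ i, HasSubgaussianMGF (X i) 2 P) :
    P.real {ω | 4 * (k : ℝ) ≤ ∑ i, X i ω ^ 2} ≤ Real.exp (-(1 / 10) * k) := by
  have hind2 : iIndepFun (fun i ω => X i ω ^ 2) P :=
    hind.comp (fun _ x => x ^ 2) fun _ => by fun_prop
  have hm2 : ∀ i, Measurable fun ω => X i ω ^ 2 := fun i => by fun_prop
  have hint := hind2.integrable_exp_mul_sum (t := 1 / 8) hm2 (s := Finset.univ)
    fun i _ => integrable_exp_sq (hm i) (hX i)
  have h := measure_ge_le_exp_mul_mgf (4 * (k : ℝ)) (by norm_num) hint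
  rw [hind2.mgf_sum hm2] at h
  simp only [Finset.sum_apply] at h
  refine h.trans ?_
  have hprod : ∏ i, mgf (fun ω => X i ω ^ 2) P (1 / 8) ≤ ∏ _i : Fin k, Real.exp (2 / 5) :=
    Finset.prod_le_prod (fun i _ => mgf_nonneg) fun i _ => mgf_sq_le (hm i) (hX i)
  rw [Finset.prod_const, Finset.card_univ, Fintype.card_fin, ← Real.exp_nat_mul] at hprod
  refine (mul_le_mul_of_nonneg_left hprod (Real.exp_pos _).le).trans ?_
  rw [← Real.exp_add]
  apply Real.exp_le_exp.2
  linarith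

/-- A variable with a subgaussian moment generating function is centred. -/
theorem integral_eq_zero_of_hasSubgaussianMGF [IsProbabilityMeasure P] {X : Ω → ℝ}
    (hX : HasSubgaussianMGF X 2 P) : ∫ ω, X ω ∂P = 0 := by
  have key : ∀ Y : Ω → ℝ, HasSubgaussianMGF Y 2 P → ∫ ω, Y ω ∂P ≤ 0 := by
    intro Y hY
    set M := ∫ ω, Y ω ∂P
    have hM : ∀ t : ℝ, 1 + t * M ≤ Real.exp (t ^ 2) := fun t => by
      have h1 : 1 + t * M = ∫ ω, (1 + t * Y ω) ∂P := by
        rw [integral_add (integrable_const _) (hY.integrable.const_mul _), integral_const_mul]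
        simp [M]
      rw [h1]
      refine (integral_mono ((integrable_const _).add (hY.integrable.const_mul _))
        (hY.integrable_exp_mul t) fun ω => ?_).trans ((hY.mgf_le t).trans (le_of_eq ?_))
      · simpa [add_comm] using Real.add_one_le_exp (t * Y ω)
      · congr 1; simp
    by_contra! hpos
    -- compare the two sides at a small positive `t`
    set t := min (1 / 2) (M / 3)
    have ht0 : 0 < t := lt_min (by norm_num) (by linarith)
    have ht1 : t ≤ 1 / 2 := min_le_left _ _
    have ht2 : t ≤ M / 3 := min_le_right _ _
    have h2 : Real.exp (t ^ 2) ≤ 1 / (1 - t ^ 2) := by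
      apply Real.exp_bound_div_one_sub_of_interval (by positivity) (by nlinarith)
    have h3 : (1 + t * M) * (1 - t ^ 2) ≤ 1 := by
      have := (hM t).trans h2
      rwa [le_div_iff₀ (by nlinarith)] at this
    have h4 : t ^ 2 ≤ 1 / 4 := by nlinarith
    have h5 : 0 < M - t - t ^ 2 * M := by nlinarith
    nlinarith [mul_pos ht0 h5]
  have h1 := key X hX
  have h2 := key (-X) hX.neg
  simp only [Pi.neg_apply, integral_neg] at h2
  linarith

end OneDimensional

/-! ### Maurey's empirical method and counting of multisets -/

section Sparsification

/-- Empirical sparsification of a convex combination: if a quadratic form is non-negative at all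
sums of `N` of the vectors `e i` (shifted by `y`), then it is almost non-negative at
`y + N • ∑ w i • e i`. -/
theorem quadratic_nonneg_of_multisets {E α : Type*} [AddCommGroup E] [Module ℝ E] [Fintype α]
    (B : E →ₗ[ℝ] E →ₗ[ℝ] ℝ) (e : α → E) (w : α → ℝ) (hw0 : ∀ i, 0 ≤ w i) (hw1 : ∑ i, w i = 1)
    (N : ℕ) : ∀ y : E,
      (∀ σ : Sym α N, 0 ≤ B (y + (σ.1.map e).sum) (y + (σ.1.map e).sum)) →
      0 ≤ B (y + (N : ℝ) • ∑ i, w i • e i) (y + (N : ℝ) • ∑ i, w i • e i)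
        + N * (∑ i, w i * B (e i) (e i) - B (∑ i, w i • e i) (∑ i, w i • e i)) := by
  set v := ∑ i, w i • e i with hv
  -- Bias–variance identity: adding a random `e i` drawn with weights `w` has the mean effect of
  -- adding `v`, plus one variance term. Each induction step averages out one summand, so `N`
  -- variances accumulate.
  have avg : ∀ y, ∑ i, w i * B (y + e i) (y + e i) =
      B (y + v) (y + v) + (∑ i, w i * B (e i) (e i) - B v v) := by
    intro y
    have h1 : B y v = ∑ i, w i * B y (e i) := by rw [hv]; simp [map_sum]
    have h2 : B v y = ∑ i, w i * B (e i) y := by rw [hv]; simp [map_sum]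
    have h3 : ∑ i, w i * B (y + e i) (y + e i) = (∑ i, w i) * B y y + ∑ i, w i * B y (e i)
        + ∑ i, w i * B (e i) y + ∑ i, w i * B (e i) (e i) := by
      rw [Finset.sum_mul, ← Finset.sum_add_distrib, ← Finset.sum_add_distrib,
        ← Finset.sum_add_distrib]
      refine Finset.sum_congr rfl fun i _ => ?_
      simp only [map_add, LinearMap.add_apply]; ring
    rw [h3, hw1, ← h1, ← h2]
    simp only [map_add, LinearMap.add_apply]; ring
  induction N with
  | zero =>
    intro y h
    simpa using h Sym.nil
  | succ N ih =>
    intro y h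
    have h1 : ∀ i, 0 ≤ B (y + e i + (N : ℝ) • v) (y + e i + (N : ℝ) • v)
        + N * (∑ i, w i * B (e i) (e i) - B v v) := by
      intro i
      refine ih (y + e i) fun σ => ?_
      have h2 : ((i ::ₛ σ).1.map e).sum = e i + (σ.1.map e).sum := by
        rw [show (i ::ₛ σ).1 = i ::ₘ σ.1 from rfl, Multiset.map_cons, Multiset.sum_cons]
      have h3 := h (i ::ₛ σ)
      rwa [h2, ← add_assoc] at h3
    have h2 := Finset.sum_nonneg fun i (_ : i ∈ Finset.univ) => mul_nonneg (hw0 i) (h1 i)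
    simp only [mul_add, Finset.sum_add_distrib] at h2
    rw [← Finset.sum_mul, hw1, one_mul] at h2
    have h3 := avg (y + (N : ℝ) • v)
    have h4 : ∀ i, y + e i + (N : ℝ) • v = y + (N : ℝ) • v + e i := fun i => by abel
    simp_rw [h4] at h2
    rw [h3] at h2
    have h5 : y + ((N + 1 : ℕ) : ℝ) • v = y + (N : ℝ) • v + v := by
      push_cast; rw [add_smul, one_smul, add_assoc]
    rw [h5]
    push_cast
    linarith

variable {n : ℕ}

/-- The signed unit vector `± e_j`. -/
noncomputable def signedUnit (a : Fin n × Bool) : EuclideanSpace ℝ (Fin n) :=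
  EuclideanSpace.single a.1 (if a.2 then 1 else -1)

theorem sum_single_smul (v : EuclideanSpace ℝ (Fin n)) :
    ∑ j, v j • EuclideanSpace.single j (1 : ℝ) = v := by
  ext i
  simp [Finset.sum_apply, Pi.single_apply]

/-- Positive and negative parts of `v j`, divided by `‖v‖₁`, serve as weights of `e_j` and `-e_j`.
-/
theorem exists_weights (v : EuclideanSpace ℝ (Fin n)) (hb : 0 < ∑ j, |v j|) :
    ∃ w : Fin n × Bool → ℝ, (∀ a, 0 ≤ w a) ∧ ∑ a, w a = 1 ∧
      ∑ a, w a • signedUnit a = (∑ j, |v j|)⁻¹ • v := by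
  set b := ∑ j, |v j|
  refine ⟨fun a => b⁻¹ * (if a.2 then max (v a.1) 0 else max (-v a.1) 0), fun a => ?_, ?_, ?_⟩
  · have : 0 ≤ (if a.2 then max (v a.1) 0 else max (-v a.1) 0) := by split_ifs <;> simp
    positivity
  · rw [← Finset.mul_sum, Fintype.sum_prod_type]
    simp only [Fintype.sum_bool, if_true, Bool.false_eq_true, if_false]
    have : ∀ j, max (v j) 0 + max (-v j) 0 = |v j| := fun j => max_zero_add_max_neg_zero_eq_abs_self _
    simp_rw [this]
    exact inv_mul_cancel₀ hb.ne'
  · conv_rhs => rw [← sum_single_smul v]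
    rw [Fintype.sum_prod_type, Finset.smul_sum]
    refine Finset.sum_congr rfl fun j _ => ?_
    simp only [Fintype.sum_bool, if_true, Bool.false_eq_true, if_false, signedUnit]
    have h1 : (EuclideanSpace.single j (-1 : ℝ)) = -EuclideanSpace.single j (1 : ℝ) := by
      ext i; by_cases h : i = j <;> simp [h]
    rw [h1, smul_neg, ← sub_eq_add_neg, ← sub_smul, smul_smul, ← mul_sub]
    congr 2
    exact max_zero_sub_max_neg_zero_eq_self _

/-- Sparsification for the form `∑ ⟨φ i, u⟩² - c‖u‖²` at `v / ‖v‖₁`. The hypothesis on the sums is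
homogeneous, so their norms need no control; on a signed unit vector the form is at most a squared
column norm, hence at most `C`. -/
theorem sum_inner_sq_ge_of_multisets {k N : ℕ} {c C : ℝ} (hc : 0 ≤ c) (hN : 1 ≤ N)
    (φ : Fin k → EuclideanSpace ℝ (Fin n))
    (h1 : ∀ σ : Sym (Fin n × Bool) N, c * ‖(σ.1.map signedUnit).sum‖ ^ 2 ≤
      ∑ i, inner ℝ (φ i) (σ.1.map signedUnit).sum ^ 2)
    (h2 : ∀ j, ∑ i, (φ i j) ^ 2 ≤ C) (v : EuclideanSpace ℝ (Fin n)) :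
    ((N : ℝ) - 1) * (c * ‖v‖ ^ 2) - (∑ j, |v j|) ^ 2 * C ≤
      ((N : ℝ) - 1) * ∑ i, inner ℝ (φ i) v ^ 2 := by
  have hb : 0 ≤ ∑ j, |v j| := Finset.sum_nonneg fun j _ => abs_nonneg _
  rcases hb.eq_or_lt with hb0 | hb0
  · have hv : v = 0 := by
      ext j
      have := (Finset.sum_eq_zero_iff_of_nonneg fun j _ => abs_nonneg (v j)).1 hb0.symm j
        (Finset.mem_univ j)
      simpa using this
    simp [hv]
  obtain ⟨w, hw0, hw1, hwv⟩ := exists_weights v hb0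
  let B : EuclideanSpace ℝ (Fin n) →ₗ[ℝ] EuclideanSpace ℝ (Fin n) →ₗ[ℝ] ℝ :=
    ∑ i, (innerₗ _ (φ i)).smulRight (innerₗ _ (φ i)) - c • innerₗ _
  have hB : ∀ u, B u u = ∑ i, inner ℝ (φ i) u ^ 2 - c * ‖u‖ ^ 2 := fun u => by
    simp [B, LinearMap.sum_apply, sq]
  have h := quadratic_nonneg_of_multisets B signedUnit w hw0 hw1 N 0 fun σ => by
    rw [zero_add, hB]; linarith [h1 σ]
  simp only [zero_add, hwv, map_smul, LinearMap.smul_apply, smul_eq_mul] at h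
  set b := ∑ j, |v j|
  have hQ : ∑ a, w a * B (signedUnit a) (signedUnit a) ≤ C := by
    calc ∑ a, w a * B (signedUnit a) (signedUnit a) ≤ ∑ a, w a * C := by
          refine Finset.sum_le_sum fun a _ => mul_le_mul_of_nonneg_left ?_ (hw0 a)
          rw [hB]
          have h3 : ∑ i, inner ℝ (φ i) (signedUnit a) ^ 2 = ∑ i, φ i a.1 ^ 2 := by
            refine Finset.sum_congr rfl fun i _ => ?_
            unfold signedUnit
            rw [EuclideanSpace.inner_single_right]
            split_ifs <;> simp
          rw [h3]
          have := h2 a.1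
          have : 0 ≤ c * ‖signedUnit a‖ ^ 2 := by positivity
          linarith
      _ = C := by rw [← Finset.sum_mul, hw1, one_mul]
  have hN0 : (0 : ℝ) < N := by exact_mod_cast hN
  -- The form at `N • (v / b)` contributes `N²`, and the variance subtracts `N` of it; hence the
  -- factor `N - 1`.
  have h4 : 0 ≤ (N : ℝ) * (((N : ℝ) - 1) * (b⁻¹ * (b⁻¹ * B v v)) + C) := by
    have := mul_le_mul_of_nonneg_left hQ hN0.le
    linarith
  have h5 : 0 ≤ ((N : ℝ) - 1) * (b⁻¹ * (b⁻¹ * B v v)) + C := by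
    by_contra! hneg
    nlinarith
  have h6 : 0 ≤ ((N : ℝ) - 1) * B v v + b ^ 2 * C := by
    have := mul_nonneg (sq_nonneg b) h5
    have e : b ^ 2 * (((N : ℝ) - 1) * (b⁻¹ * (b⁻¹ * B v v)) + C) =
        ((N : ℝ) - 1) * B v v + b ^ 2 * C := by field_simp
    linarith
  rw [hB] at h6
  linarith

/-- Stars and bars gives at most `(2n + N)^N / N!`. The factorial is essential: `s ≤ N` and `s ≤ n`
give `2n + N ≤ 3nN/s`, and `N^N / N! ≤ exp N` cancels the factor `N^N`. -/
theorem card_sym_le {s N : ℕ} (hs : 1 ≤ s) (hsn : s ≤ n) (hsN : s ≤ N) :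
    (Fintype.card (Sym (Fin n × Bool) N) : ℝ) ≤
      Real.exp (N * (Real.log 3 + Real.log (Real.exp 1 * n / s))) := by
  have hs0 : (0 : ℝ) < s := by exact_mod_cast hs
  have hn0 : (0 : ℝ) < n := by exact_mod_cast hs.trans hsn
  have hN0 : (0 : ℝ) < N := by exact_mod_cast hs.trans hsN
  have hsn' : (s : ℝ) ≤ n := by exact_mod_cast hsn
  have hsN' : (s : ℝ) ≤ N := by exact_mod_cast hsN
  rw [Sym.card_sym_eq_multichoose, Nat.multichoose_eq]
  refine (Nat.choose_le_pow_div N _).trans ?_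
  have hcard : ((Fintype.card (Fin n × Bool) + N - 1 : ℕ) : ℝ) ≤ 3 * n / s * N := by
    have h1 : ((Fintype.card (Fin n × Bool) + N - 1 : ℕ) : ℝ) ≤ 2 * n + N := by
      have : Fintype.card (Fin n × Bool) + N - 1 ≤ 2 * n + N := by simp; omega
      exact_mod_cast this
    refine h1.trans ?_
    rw [div_mul_eq_mul_div, le_div_iff₀ hs0]
    nlinarith
  have hfac := Real.pow_div_factorial_le_exp (x := N) hN0.le N
  calc _ ≤ (3 * n / s * N : ℝ) ^ N / (N.factorial : ℝ) := by gcongr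
    _ = (3 * n / s : ℝ) ^ N * ((N : ℝ) ^ N / (N.factorial : ℝ)) := by rw [mul_pow]; ring
    _ ≤ (3 * n / s : ℝ) ^ N * Real.exp N := by gcongr
    _ = Real.exp (N * (Real.log 3 + Real.log (Real.exp 1 * n / s))) := by
        rw [← Real.log_mul (by norm_num) (by positivity), Real.exp_nat_mul,
          Real.exp_log (by positivity), ← Real.exp_one_pow, ← mul_pow]
        congr 1; ring

end Sparsification

/-! ### Uniform lower bound for random rows -/

section RandomRows

variable {Ω : Type*} [MeasurableSpace Ω] {P : Measure Ω} {n k : ℕ}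

/-- The parameter is `2` because `HasSubgaussianMGF` with parameter `c` means a bound `exp (c t² /
2)`. -/
theorem IsOneSubgaussian.hasSubgaussianMGF {X : Ω → EuclideanSpace ℝ (Fin n)}
    (hX : IsOneSubgaussian P X) {v : EuclideanSpace ℝ (Fin n)} (hv : ‖v‖ ≤ 1) :
    HasSubgaussianMGF (fun ω => inner ℝ (X ω) v) 2 P where
  integrable_exp_mul t := (hX v (by nlinarith [norm_nonneg v]) t).1
  mgf_le t := by
    refine (hX v (by nlinarith [norm_nonneg v]) t).2.trans (le_of_eq ?_)
    congr 1; simp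

variable [IsProbabilityMeasure P]

theorem measure_sum_inner_sq_lt_le {φ : Fin k → Ω → EuclideanSpace ℝ (Fin n)}
    (hind : iIndepFun φ P) (hm : ∀ i, Measurable (φ i)) (hsg : ∀ i, IsOneSubgaussian P (φ i))
    (hiso : ∀ i, IsSubIsotropic P (φ i)) (u : EuclideanSpace ℝ (Fin n)) :
    P.real {ω | ∑ i, inner ℝ (φ i ω) u ^ 2 < (k : ℝ) / 50 * ‖u‖ ^ 2} ≤
      Real.exp (-(3 / 50) * k) := by
  by_cases hu : u = 0
  · subst hu
    simp [Real.exp_nonneg]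
  have hu0 : 0 < ‖u‖ := norm_pos_iff.2 hu
  set v : EuclideanSpace ℝ (Fin n) := ‖u‖⁻¹ • u with hv
  have hv1 : ‖v‖ = 1 := by rw [hv, norm_smul]; simp [hu0.ne']
  have hin : ∀ x : EuclideanSpace ℝ (Fin n), inner ℝ x u = ‖u‖ * inner ℝ x v := fun x => by
    rw [hv, inner_smul_right, mul_inv_cancel_left₀ hu0.ne']
  have h := measure_sum_sq_le_le (P := P) (X := fun i ω => inner ℝ (φ i ω) v)
    (hind.comp (fun _ x => inner ℝ x v) fun _ => by fun_prop) (fun i => by fun_prop)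
    (fun i => (hsg i).hasSubgaussianMGF hv1.le)
    (fun i => by simpa [hv1] using hiso i v)
  refine (measureReal_mono fun ω hω => ?_).trans h
  simp only [Set.mem_ofPred_eq, hin, mul_pow, ← Finset.mul_sum] at hω ⊢
  have : 0 < ‖u‖ ^ 2 := by positivity
  by_contra! hlt
  nlinarith

theorem measure_le_sum_coord_sq_le {φ : Fin k → Ω → EuclideanSpace ℝ (Fin n)}
    (hind : iIndepFun φ P) (hm : ∀ i, Measurable (φ i)) (hsg : ∀ i, IsOneSubgaussian P (φ i))
    (j : Fin n) :
    P.real {ω | 4 * (k : ℝ) ≤ ∑ i, φ i ω j ^ 2} ≤ Real.exp (-(1 / 10) * k) := by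
  have hin : ∀ x : EuclideanSpace ℝ (Fin n), inner ℝ x (EuclideanSpace.single j (1 : ℝ)) = x j :=
    fun x => by rw [EuclideanSpace.inner_single_right]; simp
  have h := measure_le_sum_sq_le (P := P)
    (X := fun i ω => inner ℝ (φ i ω) (EuclideanSpace.single j (1 : ℝ)))
    (hind.comp (fun _ x => inner ℝ x (EuclideanSpace.single j (1 : ℝ))) fun _ => by fun_prop)
    (fun i => by fun_prop) (fun i => (hsg i).hasSubgaussianMGF (by simp))
  simpa only [hin] using h

/-- A uniform lower bound for random matrices with independent, subgaussian and sub-isotropic rows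
over vectors with small `ℓ_1`-norm. -/
theorem exists_event_sum_inner_sq_ge {s : ℕ} (hs : 1 ≤ s) (hsn : s ≤ n) {R : ℝ} (hR : (s : ℝ) ≤ R)
    (hk : 147456 * R * (2 + √(Real.log (Real.exp 1 * n / s))) ^ 2 ≤ k)
    {φ : Fin k → Ω → EuclideanSpace ℝ (Fin n)}
    (hind : iIndepFun φ P) (hm : ∀ i, Measurable (φ i)) (hsg : ∀ i, IsOneSubgaussian P (φ i))
    (hiso : ∀ i, IsSubIsotropic P (φ i)) :
    ∃ F : Set Ω, MeasurableSet F ∧ P.real Fᶜ ≤ Real.exp (-(k : ℝ) / 32) ∧ ∀ ω ∈ F,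
      ∀ v : EuclideanSpace ℝ (Fin n), (∑ j, |v j|) ^ 2 ≤ 4 * R * ‖v‖ ^ 2 →
        (k : ℝ) / 128 * ‖v‖ ^ 2 ≤ ∑ i, inner ℝ (φ i ω) v ^ 2 := by
  have hs1 : (1 : ℝ) ≤ s := by exact_mod_cast hs
  have hs0 : (0 : ℝ) < s := by linarith
  have hsn' : (s : ℝ) ≤ n := by exact_mod_cast hsn
  have hn0 : (0 : ℝ) < n := by linarith
  have hR1 : 1 ≤ R := by linarith
  set Λ := Real.log (Real.exp 1 * n / s) with hΛ
  have hΛ1 : 1 ≤ Λ := by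
    rw [hΛ, Real.le_log_iff_exp_le (by positivity), le_div_iff₀ hs0]
    gcongr
  have hsq : √Λ ^ 2 = Λ := Real.sq_sqrt (by linarith)
  have hsq1 : 1 ≤ √Λ := Real.one_le_sqrt.2 hΛ1
  set L := (2 + √Λ) ^ 2 with hL
  have hL9 : 9 ≤ L := by rw [hL]; nlinarith
  have hLΛ : 4 + Λ ≤ L := by rw [hL]; nlinarith
  have hL0 : 0 < L := by linarith
  have hk0 : (0 : ℝ) ≤ k := by positivity
  have hRL : R ≤ R * L := by nlinarith
  have hLR : L ≤ R * L := by nlinarith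
  have hkbig : (147456 : ℝ) * 9 ≤ k := by nlinarith
  -- This `N` balances two demands: the entropy `N * L` is at most `k / 100`, below the exponent `3k
  -- / 50`, while `N - 1 ≥ 1472 R` makes the sparsification loss at most `16k / 1472 · ‖v‖²`, small
  -- against `k / 50 · ‖v‖²`.
  set N := ⌊(k : ℝ) / (100 * L)⌋₊ with hN
  have hNle : (N : ℝ) * (100 * L) ≤ k := by
    rw [← le_div_iff₀ (by positivity)]
    exact Nat.floor_le (by positivity)
  have hNge : 1472 * R ≤ (N : ℝ) - 1 := by
    have h1 : (k : ℝ) / (100 * L) < N + 1 := Nat.lt_floor_add_one _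
    have h2 : 1474 * R ≤ (k : ℝ) / (100 * L) := by
      rw [le_div_iff₀ (by positivity)]; nlinarith
    linarith
  have hsN : s ≤ N := by
    have : (s : ℝ) ≤ N := by linarith
    exact_mod_cast this
  have hN1 : 1 ≤ N := hs.trans hsN
  let bad₁ : Sym (Fin n × Bool) N → Set Ω := fun σ =>
    {ω | ∑ i, inner ℝ (φ i ω) (σ.1.map signedUnit).sum ^ 2 <
      (k : ℝ) / 50 * ‖(σ.1.map signedUnit).sum‖ ^ 2}
  let bad₂ : Fin n → Set Ω := fun j => {ω | 4 * (k : ℝ) ≤ ∑ i, φ i ω j ^ 2}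
  have hmeas₁ : ∀ σ, MeasurableSet (bad₁ σ) := fun σ =>
    measurableSet_lt (by fun_prop) measurable_const
  have hmeas₂ : ∀ j, MeasurableSet (bad₂ j) := fun j =>
    measurableSet_le measurable_const (by fun_prop)
  have hP₁ : P.real (⋃ σ, bad₁ σ) ≤ Real.exp (-(1 / 20) * k) := by
    calc P.real (⋃ σ, bad₁ σ) ≤ ∑ σ, P.real (bad₁ σ) := measureReal_iUnion_fintype_le _
      _ ≤ ∑ _σ : Sym (Fin n × Bool) N, Real.exp (-(3 / 50) * k) :=
          Finset.sum_le_sum fun σ _ => measure_sum_inner_sq_lt_le hind hm hsg hiso _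
      _ ≤ Real.exp (N * (Real.log 3 + Λ)) * Real.exp (-(3 / 50) * k) := by
          rw [Finset.sum_const, nsmul_eq_mul, Finset.card_univ]
          exact mul_le_mul_of_nonneg_right (card_sym_le hs hsn hsN) (Real.exp_pos _).le
      _ ≤ _ := by
          rw [← Real.exp_add]
          apply Real.exp_le_exp.2
          have h3 : Real.log 3 ≤ 2 := by
            have := Real.log_le_sub_one_of_pos (x := 3) (by norm_num); linarith
          have h4 : (N : ℝ) * (Real.log 3 + Λ) ≤ N * L := by gcongr; linarith
          linarith
  have hP₂ : P.real (⋃ j, bad₂ j) ≤ Real.exp (-(1 / 20) * k) := by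
    -- Since `exp Λ = e n / s` and `s ≤ exp s`, the union over all `n` columns costs only `s + Λ` in
    -- the exponent, which is absorbed by `k / 20`.
    have hn : (n : ℝ) ≤ Real.exp (s + Λ) := by
      rw [Real.exp_add, hΛ, Real.exp_log (by positivity)]
      have h1 : (s : ℝ) ≤ Real.exp s := by linarith [Real.add_one_le_exp (s : ℝ)]
      have h2 : 1 ≤ Real.exp 1 := Real.one_le_exp zero_le_one
      calc (n : ℝ) = s * (1 * n / s) := by field_simp
        _ ≤ _ := by gcongr
    calc P.real (⋃ j, bad₂ j) ≤ ∑ j, P.real (bad₂ j) := measureReal_iUnion_fintype_le _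
      _ ≤ ∑ _j : Fin n, Real.exp (-(1 / 10) * k) :=
          Finset.sum_le_sum fun j _ => measure_le_sum_coord_sq_le hind hm hsg j
      _ ≤ Real.exp (s + Λ) * Real.exp (-(1 / 10) * k) := by
          rw [Finset.sum_const, nsmul_eq_mul, Finset.card_univ, Fintype.card_fin]
          gcongr
      _ ≤ _ := by
          rw [← Real.exp_add]
          apply Real.exp_le_exp.2
          linarith
  refine ⟨((⋃ σ, bad₁ σ) ∪ ⋃ j, bad₂ j)ᶜ,
    ((MeasurableSet.iUnion hmeas₁).union (MeasurableSet.iUnion hmeas₂)).compl, ?_, ?_⟩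
  · rw [compl_compl]
    refine (measureReal_union_le _ _).trans ((add_le_add hP₁ hP₂).trans ?_)
    -- The factor `2` from the two bad events is absorbed by weakening the rate from `1/20` to `1/32
    -- = 1/20 - 3/160`.
    have h2 : (2 : ℝ) ≤ Real.exp (3 / 160 * k) := by
      have := Real.add_one_le_exp (3 / 160 * (k : ℝ)); linarith
    have h3 : Real.exp (-(k : ℝ) / 32) = Real.exp (3 / 160 * k) * Real.exp (-(1 / 20) * k) := by
      rw [← Real.exp_add]; congr 1; ring
    rw [h3, ← two_mul]
    gcongr
  · intro ω hω v hv
    simp only [Set.mem_compl_iff, Set.mem_union, Set.mem_iUnion, not_or, not_exists] at hω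
    have h1 : ∀ σ : Sym (Fin n × Bool) N, (k : ℝ) / 50 * ‖(σ.1.map signedUnit).sum‖ ^ 2 ≤
        ∑ i, inner ℝ (φ i ω) (σ.1.map signedUnit).sum ^ 2 := fun σ => by
      simpa [bad₁] using hω.1 σ
    have h2 : ∀ j, ∑ i, φ i ω j ^ 2 ≤ 4 * (k : ℝ) := fun j => by
      have := hω.2 j
      simp only [bad₂, Set.mem_ofPred_eq, not_le] at this
      exact this.le
    have h3 := sum_inner_sq_ge_of_multisets (by positivity) hN1 (fun i => φ i ω) h1 h2 v
    set T := ∑ i, inner ℝ (φ i ω) v ^ 2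
    set ν := ‖v‖ ^ 2
    have hν : 0 ≤ ν := by positivity
    have hM : 0 < (N : ℝ) - 1 := by linarith
    have h4 : (∑ j, |v j|) ^ 2 * (4 * (k : ℝ)) ≤ 4 * R * ν * (4 * k) := by gcongr
    have h5 : 4 * R * ν * (4 * (k : ℝ)) ≤ ((N : ℝ) - 1) * ((16 / 1472) * k * ν) := by
      have := mul_le_mul_of_nonneg_right hNge (mul_nonneg hk0 hν)
      linarith
    have h6 : ((N : ℝ) - 1) * ((k : ℝ) / 128 * ν) ≤ ((N : ℝ) - 1) * T := by
      have : 0 ≤ ((N : ℝ) - 1) * (k * ν) := by positivity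
      linarith
    exact le_of_mul_le_mul_left h6 hM

end RandomRows

/-! ### Normalized differences of independent rows -/

section Pairs

variable {Ω : Type*} [MeasurableSpace Ω] {P : Measure Ω} {n : ℕ}

/-- Disjoint blocks of an independent family are independent. -/
theorem iIndepFun_curry {ι κ β : Type*} [MeasurableSpace β]
    {X : ι → κ → Ω → β} (mX : ∀ i j, Measurable (X i j))
    (h : iIndepFun (fun (p : (_ : ι) × κ) ω => X p.1 p.2 ω) P) :
    iIndepFun (fun i ω => (X i · ω)) P := by
  have := h.isProbabilityMeasure
  have hp : ∀ i j, IsProbabilityMeasure (P.map (X i j)) :=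
    fun i j => Measure.isProbabilityMeasure_map (mX i j).aemeasurable
  have hrow : ∀ i, iIndepFun (X i) P := fun i =>
    h.precomp (g := fun j => (⟨i, j⟩ : (_ : ι) × κ)) fun j j' hj => by simpa using hj
  have hc : (MeasurableEquiv.piCurry fun (_ : ι) (_ : κ) => β) ∘ (fun ω p => X p.1 p.2 ω) =
      fun ω i j => X i j ω := by
    ext; simp [Sigma.curry]
  rw [iIndepFun_iff_map_fun_eq_infinitePi_map (by fun_prop), ← hc,
    ← Measure.map_map (by fun_prop) (by fun_prop),
    (iIndepFun_iff_map_fun_eq_infinitePi_map (by fun_prop)).1 h,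
    Measure.infinitePi_map_piCurry (fun i j => P.map (X i j))]
  congrm Measure.infinitePi fun i => ?_
  rw [(iIndepFun_iff_map_fun_eq_infinitePi_map (by fun_prop)).1 (hrow i)]

theorem IsOneSubgaussian.of_identDistrib {X Y : Ω → EuclideanSpace ℝ (Fin n)}
    (h : IdentDistrib X Y P P) (hY : IsOneSubgaussian P Y) : IsOneSubgaussian P X := by
  intro v hv t
  have hc := h.comp (u := fun x => Real.exp (t * inner ℝ x v)) (by fun_prop)
  exact ⟨hc.integrable_iff.2 (hY v hv t).1, hc.integral_eq.trans_le (hY v hv t).2⟩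

theorem IsSubIsotropic.of_identDistrib {X Y : Ω → EuclideanSpace ℝ (Fin n)}
    (h : IdentDistrib X Y P P) (hY : IsSubIsotropic P Y) : IsSubIsotropic P X := by
  intro v
  have hc := h.comp (u := fun x => inner ℝ x v ^ 2) (by fun_prop)
  exact (hY v).trans_eq hc.integral_eq.symm

/-- Centring makes the cross term vanish in the second moment of a difference. -/
theorem IsOneSubgaussian.memLp_and_integral [IsProbabilityMeasure P]
    {X : Ω → EuclideanSpace ℝ (Fin n)} (hX : IsOneSubgaussian P X) (v : EuclideanSpace ℝ (Fin n)) :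
    MemLp (fun ω => inner ℝ (X ω) v) 2 P ∧ ∫ ω, inner ℝ (X ω) v ∂P = 0 := by
  have hin : ∀ x : EuclideanSpace ℝ (Fin n), inner ℝ x v = ‖v‖ * inner ℝ x (‖v‖⁻¹ • v) := by
    intro x
    rcases eq_or_ne v 0 with rfl | hv
    · simp
    · rw [inner_smul_right, mul_inv_cancel_left₀ (norm_ne_zero_iff.2 hv)]
  have hv1 : ‖‖v‖⁻¹ • v‖ ≤ 1 := by
    rw [norm_smul, norm_inv, norm_norm]; exact inv_mul_le_one
  have h := hX.hasSubgaussianMGF hv1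
  simp_rw [hin]
  refine ⟨(h.memLp 2).const_mul _, ?_⟩
  rw [integral_const_mul, integral_eq_zero_of_hasSubgaussianMGF h, mul_zero]

/-- The normalized difference of two vectors. -/
noncomputable def pairDiff (x y : EuclideanSpace ℝ (Fin n)) : EuclideanSpace ℝ (Fin n) :=
  (√2)⁻¹ • (x - y)

theorem inner_pairDiff (x y v : EuclideanSpace ℝ (Fin n)) :
    inner ℝ (pairDiff x y) v = (√2)⁻¹ * (inner ℝ x v - inner ℝ y v) := by
  rw [pairDiff, real_inner_smul_left, inner_sub_left]

theorem inv_sqrt_two_sq : (√2 : ℝ)⁻¹ ^ 2 = 1 / 2 := by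
  rw [inv_pow, Real.sq_sqrt (by norm_num)]; norm_num

variable {X Y : Ω → EuclideanSpace ℝ (Fin n)}

/-- The subgaussian parameters of independent variables add, and the factor `(√2)⁻¹` halves their
sum again. -/
theorem IsOneSubgaussian.pairDiff (hX : IsOneSubgaussian P X) (hY : IsOneSubgaussian P Y)
    (h : IndepFun X Y P) : IsOneSubgaussian P fun ω => pairDiff (X ω) (Y ω) := by
  intro v hv t
  have hv1 : ‖v‖ ≤ 1 := by nlinarith [norm_nonneg v]
  have hind : IndepFun (fun ω => inner ℝ (X ω) v) (fun ω => inner ℝ (Y ω) v) P :=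
    h.comp (φ := fun x => inner ℝ x v) (ψ := fun x => inner ℝ x v) (by fun_prop) (by fun_prop)
  have hs := ((hX.hasSubgaussianMGF hv1).sub_of_indepFun (hY.hasSubgaussianMGF hv1)
    hind).const_mul (√2)⁻¹
  simp_rw [inner_pairDiff]
  refine ⟨hs.integrable_exp_mul t, (hs.mgf_le t).trans (le_of_eq ?_)⟩
  congr 1
  change (√2)⁻¹ ^ 2 * ((2 : ℝ) + 2) * t ^ 2 / 2 = t ^ 2
  rw [inv_sqrt_two_sq]
  ring

theorem IsSubIsotropic.pairDiff [IsProbabilityMeasure P] (hX : IsOneSubgaussian P X)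
    (hY : IsOneSubgaussian P Y) (hX' : IsSubIsotropic P X) (hY' : IsSubIsotropic P Y)
    (h : IndepFun X Y P) : IsSubIsotropic P fun ω => pairDiff (X ω) (Y ω) := by
  intro v
  have hind : IndepFun (fun ω => inner ℝ (X ω) v) (fun ω => inner ℝ (Y ω) v) P :=
    h.comp (φ := fun x => inner ℝ x v) (ψ := fun x => inner ℝ x v) (by fun_prop) (by fun_prop)
  obtain ⟨hXm, hX0⟩ := hX.memLp_and_integral v
  obtain ⟨hYm, hY0⟩ := hY.memLp_and_integral v
  have hprod : ∫ ω, inner ℝ (X ω) v * inner ℝ (Y ω) v ∂P = 0 := by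
    rw [hind.integral_fun_mul_eq_mul_integral hXm.aestronglyMeasurable hYm.aestronglyMeasurable,
      hX0, zero_mul]
  have hmul : Integrable (fun ω => inner ℝ (X ω) v * inner ℝ (Y ω) v) P := hXm.integrable_mul hYm
  have he : ∀ ω, inner ℝ (BiasedNNLS.pairDiff (X ω) (Y ω)) v ^ 2 =
      1 / 2 * (inner ℝ (X ω) v ^ 2 + inner ℝ (Y ω) v ^ 2)
        - inner ℝ (X ω) v * inner ℝ (Y ω) v := fun ω => by
    rw [inner_pairDiff, mul_pow, inv_sqrt_two_sq]; ring
  simp_rw [he]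
  have hsum : Integrable (fun ω => inner ℝ (X ω) v ^ 2 + inner ℝ (Y ω) v ^ 2) P :=
    hXm.integrable_sq.add hYm.integrable_sq
  rw [integral_sub (hsum.const_mul _) hmul, integral_const_mul, integral_add hXm.integrable_sq hYm.integrable_sq, hprod]
  have := hX' v
  have := hY' v
  linarith

end Pairs

/-! ### The biased matrix: null space property and weights -/

section BiasedMatrix

variable {m n : ℕ}

theorem biasedMatrix_mulVec (a : Fin m → EuclideanSpace ℝ (Fin n)) (μ : ℝ)
    (v : EuclideanSpace ℝ (Fin n)) (i : Fin m) :
    (biasedMatrix a μ).mulVec v i = inner ℝ (a i) v + μ * ∑ j, v j := by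
  simp only [biasedMatrix, Matrix.mulVec, dotProduct, Matrix.of_apply, PiLp.inner_apply,
    RCLike.inner_apply, conj_trivial, Finset.mul_sum, ← Finset.sum_add_distrib]
  exact Finset.sum_congr rfl fun j _ => by ring

/-- The index of a member of the `i`-th of the `m / 2` disjoint pairs `{i, m / 2 + i}`. -/
def pairIndex (m : ℕ) (i : Fin (m / 2)) (b : Bool) : Fin m :=
  if b then ⟨m / 2 + i, by omega⟩ else ⟨i, by omega⟩

theorem pairIndex_injective (m : ℕ) :
    Function.Injective fun p : (_ : Fin (m / 2)) × Bool => pairIndex m p.1 p.2 := by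
  rintro ⟨i, b⟩ ⟨j, c⟩ h
  have hi := i.2
  have hj := j.2
  cases b <;> cases c <;> simp [pairIndex, Fin.ext_iff] at h ⊢ <;> omega

/-- The bias adds the same number to both measurements of a pair and cancels in the difference; then
`(x - y)² / 2 ≤ x² + y²`, and the pairs are disjoint. -/
theorem sum_pairDiff_sq_le (a : Fin m → EuclideanSpace ℝ (Fin n)) (μ : ℝ)
    (v : EuclideanSpace ℝ (Fin n)) :
    ∑ i, inner ℝ (pairDiff (a (pairIndex m i false)) (a (pairIndex m i true))) v ^ 2 ≤
      ellNorm 2 ((biasedMatrix a μ).mulVec v) ^ 2 := by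
  rw [ellNorm_two_sq]
  set g : Fin m → ℝ := (biasedMatrix a μ).mulVec v with hg
  have h1 : ∑ p : (_ : Fin (m / 2)) × Bool, g (pairIndex m p.1 p.2) ^ 2 ≤ ∑ i, g i ^ 2 := by
    classical
    rw [← Finset.sum_image (f := fun i => g i ^ 2) (g := fun p : (_ : Fin (m / 2)) × Bool =>
      pairIndex m p.1 p.2) (s := Finset.univ) fun p _ q _ h => pairIndex_injective m h]
    exact Finset.sum_le_univ_sum_of_nonneg fun i => sq_nonneg _
  refine le_trans ?_ h1
  rw [Fintype.sum_sigma]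
  refine Finset.sum_le_sum fun i _ => ?_
  rw [Fintype.sum_bool, inner_pairDiff, mul_pow, inv_sqrt_two_sq, hg, biasedMatrix_mulVec,
    biasedMatrix_mulVec]
  set c := μ * ∑ j, v j
  nlinarith [sq_nonneg (inner ℝ (a (pairIndex m i true)) v + c
    + (inner ℝ (a (pairIndex m i false)) v + c))]

/-- Either the inequality holds without the term `τ‖Av‖₂`, or the tail of `v` is dominated by its
part on `S`. In the second case `‖v‖₁ ≤ 2 (s^(1-1/q)/ρ) ‖v‖₂`, so `v` is in the cone, and `‖v_S‖_q ≤
‖v‖₂` (here `q ≥ 2` enters) is bounded by `‖Av‖₂ / c`. -/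
theorem nullSpaceProperty_of_lower_bound {A : Matrix (Fin m) (Fin n) ℝ} {q ρ c : ℝ} {s : ℕ}
    (hq : 2 ≤ q) (hρ0 : 0 < ρ) (hρ1 : ρ ≤ 1) (hc : 0 < c) (hs : 1 ≤ s)
    (h : ∀ v : EuclideanSpace ℝ (Fin n),
      (∑ j, |v j|) ^ 2 ≤ 4 * ((s : ℝ) ^ (2 - 2 / q) / ρ ^ 2) * ‖v‖ ^ 2 →
        c ^ 2 * ‖v‖ ^ 2 ≤ ellNorm 2 (A.mulVec v) ^ 2) :
    NullSpaceProperty A q s ρ (1 / c) := by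
  intro v S hS
  have hq0 : 0 < q := by linarith
  have hs0 : (0 : ℝ) < s := by exact_mod_cast hs
  have hA0 : 0 ≤ ellNorm 2 (A.mulVec v) := ellNorm_nonneg two_pos _
  by_cases hcone : ellNorm q ((S : Set (Fin n)).indicator v) ≤
      ρ / (s : ℝ) ^ (1 - 1 / q) * ellNorm 1 ((S : Set (Fin n))ᶜ.indicator v)
  · have : 0 ≤ 1 / c * ellNorm 2 (A.mulVec v) := by positivity
    linarith
  push Not at hcone
  set a := (s : ℝ) ^ (1 - 1 / q) with ha
  have ha0 : 0 < a := by positivity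
  have ha2 : (s : ℝ) ^ (2 - 2 / q) = a ^ 2 := by
    rw [ha, ← Real.rpow_natCast, ← Real.rpow_mul hs0.le]; congr 1; push_cast; ring
  set x := ellNorm q ((S : Set (Fin n)).indicator v) with hx
  have hx0 : 0 ≤ x := ellNorm_nonneg hq0 _
  have hx2 : x ≤ ellNorm 2 v :=
    (ellNorm_antitone_two hq _).trans (ellNorm_mono two_pos (abs_indicator_le _ v))
  have h1 : ellNorm 1 ((S : Set (Fin n)).indicator v) ≤ a * x := by
    have := ellNorm_indicator_le_card le_rfl (by linarith : 1 ≤ q) S hS v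
    rwa [one_div_one] at this
  have h2 : ellNorm 1 ((S : Set (Fin n))ᶜ.indicator v) ≤ a / ρ * x := by
    rw [div_mul_eq_mul_div, le_div_iff₀ hρ0]
    rw [div_mul_eq_mul_div, div_lt_iff₀ ha0] at hcone
    linarith
  have h3 : a * x ≤ a / ρ * x := by
    gcongr
    rw [le_div_iff₀ hρ0]; nlinarith
  have h4 : ∑ j, |v j| ≤ 2 * (a / ρ) * ellNorm 2 v := by
    rw [← ellNorm_one, ellNorm_one_split S v]
    have : a / ρ * x ≤ a / ρ * ellNorm 2 v := by gcongr
    linarith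
  have hnorm : ‖(WithLp.toLp 2 v : EuclideanSpace ℝ (Fin n))‖ ^ 2 = ellNorm 2 v ^ 2 := by
    rw [EuclideanSpace.norm_sq_eq, ellNorm_two_sq]; simp
  have h5 := h (WithLp.toLp 2 v) (by
    rw [hnorm, ha2]
    refine (pow_le_pow_left₀ (Finset.sum_nonneg fun j _ => abs_nonneg _) h4 2).trans (le_of_eq ?_)
    field_simp; ring)
  rw [hnorm, ← mul_pow] at h5
  have h6 : c * ellNorm 2 v ≤ ellNorm 2 (A.mulVec v) := le_of_sq_le_sq h5 hA0
  have h7 : ellNorm 2 v ≤ 1 / c * ellNorm 2 (A.mulVec v) := by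
    rw [one_div, inv_mul_eq_div, le_div_iff₀ hc]; linarith
  have h8 : 0 ≤ ρ / a * ellNorm 1 ((S : Set (Fin n))ᶜ.indicator v) := by
    have := ellNorm_nonneg one_pos ((S : Set (Fin n))ᶜ.indicator v)
    positivity
  linarith

theorem transpose_biasedMatrix_mulVec (hm : 0 < m) {μ : ℝ} (hμ : 0 < μ)
    (a : Fin m → EuclideanSpace ℝ (Fin n)) (j : Fin n) :
    (biasedMatrix a μ).transpose.mulVec (fun _ => 1 / (m * μ)) j =
      1 + (∑ i, a i j) / (m * μ) := by
  have hm0 : (0 : ℝ) < m := by exact_mod_cast hm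
  simp only [biasedMatrix, Matrix.mulVec, dotProduct, Matrix.transpose_apply, Matrix.of_apply,
    ← Finset.sum_mul, Finset.sum_add_distrib, Finset.sum_const, Finset.card_univ,
    Fintype.card_fin, nsmul_eq_mul]
  field_simp
  ring

theorem ellNorm_two_const (hm : 0 < m) {μ : ℝ} (hμ : 0 < μ) :
    ellNorm 2 (fun _ : Fin m => 1 / (m * μ)) = 1 / (√m * μ) := by
  have hm0 : (0 : ℝ) < m := by exact_mod_cast hm
  have hs : √(m : ℝ) ^ 2 = m := Real.sq_sqrt hm0.le
  have hs0 : 0 < √(m : ℝ) := Real.sqrt_pos.2 hm0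
  refine (sq_eq_sq₀ (ellNorm_nonneg two_pos _) (by positivity)).1 ?_
  rw [ellNorm_two_sq]
  simp only [Finset.sum_const, Finset.card_univ, Fintype.card_fin, nsmul_eq_mul, div_pow, mul_pow,
    hs, one_pow]
  field_simp

/-- The weights `Aᵀ t` concentrate around `1`. -/
theorem exists_event_column_sum {Ω : Type*} [MeasurableSpace Ω] {P : Measure Ω}
    [IsProbabilityMeasure P] {μ : ℝ} (hμ : 0 < μ) (hm : 0 < m)
    {a : Fin m → Ω → EuclideanSpace ℝ (Fin n)} (ha : ∀ i, Measurable (a i))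
    (hcol : ∀ j : Fin n, IsOneSubgaussian P (fun ω => column (fun i => a i ω) j)) :
    ∃ F : Set Ω, MeasurableSet F ∧ P.real Fᶜ ≤ 2 * n * Real.exp (-(μ ^ 2 * m) / 16) ∧
      ∀ ω ∈ F, ∀ j, |∑ i, a i ω j| < m * μ / 2 := by
  have hm0 : (0 : ℝ) < m := by exact_mod_cast hm
  have hs : √(m : ℝ) ^ 2 = m := Real.sq_sqrt hm0.le
  have hs0 : 0 < √(m : ℝ) := Real.sqrt_pos.2 hm0
  let bad : Fin n → Set Ω := fun j => {ω | m * μ / 2 ≤ |∑ i, a i ω j|}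
  have hmeas : ∀ j, MeasurableSet (bad j) := fun j =>
    measurableSet_le measurable_const (by fun_prop)
  have hbad : ∀ j, P.real (bad j) ≤ 2 * Real.exp (-(μ ^ 2 * m) / 16) := by
    intro j
    -- A column sum is `√m` times the inner product of the column with this unit vector, so the
    -- threshold becomes `√m μ / 2`.
    let v : EuclideanSpace ℝ (Fin m) := WithLp.toLp 2 fun _ => (√(m : ℝ))⁻¹
    have hv : ‖v‖ ≤ 1 := by
      rw [← sq_le_one_iff₀ (norm_nonneg _), EuclideanSpace.norm_sq_eq]
      simp [v, hs, hm0.ne']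
    have h := (hcol j).hasSubgaussianMGF hv
    have hin : ∀ ω, inner ℝ (column (fun i => a i ω) j) v = (√(m : ℝ))⁻¹ * ∑ i, a i ω j := by
      intro ω
      simp [column, v, PiLp.inner_apply, Finset.mul_sum]
    have hε : (0 : ℝ) ≤ √m * μ / 2 := by positivity
    have h1 := h.measure_ge_le hε
    have h2 := h.neg.measure_ge_le hε
    have he : -(√(m : ℝ) * μ / 2) ^ 2 / (2 * ((2 : NNReal) : ℝ)) = -(μ ^ 2 * m) / 16 := by
      rw [div_pow, mul_pow, hs]; push_cast; ring
    rw [he] at h1 h2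
    have hsub : bad j ⊆ {ω | √m * μ / 2 ≤ inner ℝ (column (fun i => a i ω) j) v} ∪
        {ω | √m * μ / 2 ≤ (-fun ω => inner ℝ (column (fun i => a i ω) j) v) ω} := by
      intro ω hω
      have hω' : m * μ / 2 ≤ |∑ i, a i ω j| := hω
      simp only [Set.mem_union, Set.mem_ofPred_eq, Pi.neg_apply, hin]
      have hm' : √(m : ℝ) * μ / 2 = (√(m : ℝ))⁻¹ * (m * μ / 2) := by
        field_simp
        rw [hs]
      rw [hm', ← mul_neg]
      rcases le_abs.1 hω' with h' | h'
      · left; gcongr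
      · right; gcongr
    refine (measureReal_mono hsub).trans ((measureReal_union_le _ _).trans ?_)
    linarith
  refine ⟨(⋃ j, bad j)ᶜ, (MeasurableSet.iUnion hmeas).compl, ?_, fun ω hω j => ?_⟩
  · rw [compl_compl]
    refine (measureReal_iUnion_fintype_le _).trans ((Finset.sum_le_sum fun j _ => hbad j).trans ?_)
    rw [Finset.sum_const, nsmul_eq_mul, Finset.card_univ, Fintype.card_fin]
    linarith
  · simp only [Set.mem_compl_iff, Set.mem_iUnion, not_exists] at hω
    exact not_le.1 (hω j)

theorem specNorm_inv_diagonal {d : Fin n → ℝ} (hd : ∀ j, 0 < d j) :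
    specNorm (Matrix.diagonal d)⁻¹ = ‖fun j => (d j)⁻¹‖ := by
  rw [← specNorm_diagonal, Matrix.inv_eq_right_inv (B := Matrix.diagonal fun j => (d j)⁻¹)]
  rw [Matrix.diagonal_mul_diagonal, ← Matrix.diagonal_one]
  congr 1
  ext j
  exact mul_inv_cancel₀ (hd j).ne'

theorem norm_weights_lt {d : Fin n → ℝ} (hd : ∀ j, 1 / 2 < d j ∧ d j < 3 / 2) :
    ‖d‖ < 3 / 2 ∧ ‖fun j => (d j)⁻¹‖ < 2 ∧ (∀ j, d j ≤ ‖d‖) ∧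
      ∀ j, 1 ≤ ‖fun j => (d j)⁻¹‖ * d j := by
  have hpos : ∀ j, 0 < d j := fun j => by linarith [(hd j).1]
  refine ⟨?_, ?_, fun j => ?_, fun j => ?_⟩
  · rw [pi_norm_lt_iff (by norm_num)]
    intro j
    rw [Real.norm_eq_abs, abs_of_pos (hpos j)]
    exact (hd j).2
  · rw [pi_norm_lt_iff (by norm_num)]
    intro j
    rw [Real.norm_eq_abs, abs_of_pos (inv_pos.2 (hpos j)), inv_lt_comm₀ (hpos j) (by norm_num)]
    linarith [(hd j).1]
  · exact (le_abs_self _).trans (norm_le_pi_norm d j)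
  · have h := (le_abs_self _).trans (norm_le_pi_norm (fun j => (d j)⁻¹) j)
    have := mul_le_mul_of_nonneg_right h (hpos j).le
    rwa [inv_mul_cancel₀ (hpos j).ne'] at this

end BiasedMatrix

end BiasedNNLS

/-! ### Assembly of the main theorem -/

theorem theorem4 (ρ q : ℝ) (hρ0 : 0 < ρ) (hρ1 : ρ < 1 / 3) (hq : 2 ≤ q)
    (m n s : ℕ) (hs : 1 ≤ s) (hsn : s ≤ n)
    (hm : 2 * 384 ^ 2 / ρ ^ 2 * (s : ℝ) ^ (2 - 2 / q)
        * (2 + Real.sqrt (Real.log (Real.exp 1 * n / s))) ^ 2 + 1 ≤ (m : ℝ)) :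
    ∃ τ : ℝ, 0 < τ ∧
      Real.sqrt ((m : ℝ) - 1) / 16
          - 3 * (s : ℝ) ^ (1 - 1 / q) / ρ * (8 * Real.sqrt 2)
              * (2 + Real.sqrt (Real.log (Real.exp 1 * n / s))) ≤ 1 / τ ∧
      ∀ (Ω : Type*) [MeasurableSpace Ω] (P : Measure Ω) [IsProbabilityMeasure P]
        (μ : ℝ) (a₀ : Ω → EuclideanSpace ℝ (Fin n)) (a : Fin m → Ω → EuclideanSpace ℝ (Fin n)),
        0 < μ →
        (∀ i, Measurable (a i)) →
        iIndepFun a P →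
        (∀ i, IdentDistrib (a i) a₀ P P) →
        IsSubIsotropic P a₀ →
        IsOneSubgaussian P a₀ →
        (∀ j : Fin n, IsOneSubgaussian P (fun ω => column (fun i => a i ω) j)) →
        ∃ E : Set Ω, MeasurableSet E ∧
          1 - Real.exp (-((m : ℝ) - 1) / 64) - 2 * n * Real.exp (-(μ ^ 2 * m) / 16) ≤ P.real E ∧
          ∀ ω ∈ E,
            let A : Matrix (Fin m) (Fin n) ℝ := biasedMatrix (fun i => a i ω) μ
            let t : Fin m → ℝ := fun _ => 1 / (m * μ)
            let κ : ℝ := condNumber A t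
            let w : ℝ := specNorm (weight A t)⁻¹
            NullSpaceProperty A q s ρ τ ∧
            (∀ j, 0 < A.transpose.mulVec t j) ∧ κ < 3 ∧ w < 2 ∧
            ∀ p : ℝ, 1 ≤ p → p ≤ q →
              ∀ x₀ : Fin n → ℝ, (∀ j, 0 ≤ x₀ j) → ∀ (z : Fin m → ℝ) (x : Fin n → ℝ),
                IsNNLSSolution A (A.mulVec x₀ + z) x →
                ellNorm p (x - x₀) ≤
                  constC κ ρ / (s : ℝ) ^ (1 - 1 / p) * bestApproxError s 1 x₀
                    + constD κ ρ w / (s : ℝ) ^ (1 / q - 1 / p)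
                        * (1 / (Real.sqrt m * μ) + τ) * ellNorm 2 z := by
  have hs0 : (0 : ℝ) < s := by exact_mod_cast hs
  have hs1 : (1 : ℝ) ≤ s := by exact_mod_cast hs
  have hq0 : 0 < q := by linarith
  set R := (s : ℝ) ^ (2 - 2 / q) / ρ ^ 2 with hR
  set L := 2 + √(Real.log (Real.exp 1 * n / s)) with hL
  have hL2 : 2 ≤ L := by
    have := Real.sqrt_nonneg (Real.log (Real.exp 1 * n / s))
    linarith
  have hsR : (s : ℝ) ≤ R := by
    have h1 : (s : ℝ) ^ (1 : ℝ) ≤ (s : ℝ) ^ (2 - 2 / q) := by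
      apply Real.rpow_le_rpow_of_exponent_le hs1
      have : 2 / q ≤ 1 := by rw [div_le_one hq0]; exact hq
      linarith
    rw [Real.rpow_one] at h1
    rw [hR, le_div_iff₀ (by positivity)]
    have : ρ ^ 2 ≤ 1 := by nlinarith
    nlinarith
  have hmR : 294912 * R * L ^ 2 ≤ (m : ℝ) - 1 := by
    have : 2 * 384 ^ 2 / ρ ^ 2 * (s : ℝ) ^ (2 - 2 / q) * L ^ 2 = 294912 * R * L ^ 2 := by
      rw [hR]; ring
    linarith
  have hm1 : 0 < (m : ℝ) - 1 := by
    have : 0 < 294912 * R * L ^ 2 := by positivity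
    linarith
  have hm0 : 0 < m := by
    have : (0 : ℝ) < m := by linarith
    exact_mod_cast this
  -- An odd `m` leaves one row unpaired, hence `m - 1`.
  have hk : ((m : ℝ) - 1) / 2 ≤ ((m / 2 : ℕ) : ℝ) := by
    have : m ≤ 2 * (m / 2) + 1 := by omega
    have : (m : ℝ) ≤ 2 * ((m / 2 : ℕ) : ℝ) + 1 := by exact_mod_cast this
    linarith
  -- Chosen so that `c² = (m - 1) / 256` is at most `k / 128` for `k = m / 2` pairs. The required
  -- bound on `1 / τ` subtracts a non-negative term from this `c`, so `τ = 1 / c` suffices.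
  set c := √((m : ℝ) - 1) / 16 with hc
  have hc0 : 0 < c := by have := Real.sqrt_pos.2 hm1; positivity
  have hc2 : c ^ 2 = ((m : ℝ) - 1) / 256 := by
    rw [hc, div_pow, Real.sq_sqrt hm1.le]; norm_num
  refine ⟨1 / c, by positivity, ?_, ?_⟩
  · rw [one_div_one_div]
    have : 0 ≤ 3 * (s : ℝ) ^ (1 - 1 / q) / ρ * (8 * √2) * L := by positivity
    linarith
  intro Ω _ P _ μ a₀ a hμ ha hind hid hiso hsg hcol
  have hsg' : ∀ i, IsOneSubgaussian P (a i) := fun i => .of_identDistrib (hid i) hsg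
  have hiso' : ∀ i, IsSubIsotropic P (a i) := fun i => .of_identDistrib (hid i) hiso
  let φ : Fin (m / 2) → Ω → EuclideanSpace ℝ (Fin n) := fun i ω =>
    pairDiff (a (pairIndex m i false) ω) (a (pairIndex m i true) ω)
  have hpd : Measurable fun z : Bool → EuclideanSpace ℝ (Fin n) =>
      pairDiff (z false) (z true) := by
    unfold pairDiff; fun_prop
  have hφm : ∀ i, Measurable (φ i) := fun i => by
    simp only [φ, pairDiff]; fun_prop
  have hφind : iIndepFun φ P :=
    (iIndepFun_curry (X := fun i b => a (pairIndex m i b)) (fun i b => ha _)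
      (hind.precomp (pairIndex_injective m))).comp (fun _ z => pairDiff (z false) (z true))
      fun _ => hpd
  have hpair : ∀ i, IndepFun (a (pairIndex m i false)) (a (pairIndex m i true)) P := fun i => by
    refine hind.indepFun fun h => ?_
    have := @pairIndex_injective m ⟨i, false⟩ ⟨i, true⟩ h
    simp at this
  obtain ⟨F, hF, hPF, hFω⟩ := exists_event_sum_inner_sq_ge hs hsn hsR
    (by rw [← hL]; linarith) hφind hφm
    (fun i => (hsg' _).pairDiff (hsg' _) (hpair i))
    (fun i => .pairDiff (hsg' _) (hsg' _) (hiso' _) (hiso' _) (hpair i))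
  obtain ⟨G, hG, hPG, hGω⟩ := exists_event_column_sum hμ hm0 ha hcol
  refine ⟨F ∩ G, hF.inter hG, ?_, ?_⟩
  · have h1 : P.real (F ∩ G)ᶜ ≤ P.real Fᶜ + P.real Gᶜ := by
      rw [Set.compl_inter]; exact measureReal_union_le _ _
    rw [probReal_compl_eq_one_sub (hF.inter hG)] at h1
    have h2 : Real.exp (-((m / 2 : ℕ) : ℝ) / 32) ≤ Real.exp (-((m : ℝ) - 1) / 64) := by
      apply Real.exp_le_exp.2; linarith
    linarith
  rintro ω ⟨hωF, hωG⟩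
  intro A t κ w
  have hmpos : (0 : ℝ) < m := by exact_mod_cast hm0
  have hd : ∀ j, 1 / 2 < A.transpose.mulVec t j ∧ A.transpose.mulVec t j < 3 / 2 := fun j => by
    have hbound := hGω ω hωG j
    have h0 : A.transpose.mulVec t j = 1 + (∑ i, a i ω j) / (m * μ) :=
      transpose_biasedMatrix_mulVec hm0 hμ _ j
    have h1 : |(∑ i, a i ω j) / (m * μ)| < 1 / 2 := by
      rw [abs_div, abs_of_pos (by positivity : 0 < m * μ), div_lt_iff₀ (by positivity)]
      linarith
    rw [h0]
    have := abs_lt.1 h1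
    constructor <;> linarith
  have hd0 : ∀ j, 0 < A.transpose.mulVec t j := fun j => by linarith [(hd j).1]
  obtain ⟨hn1, hn2, hn3, hn4⟩ := norm_weights_lt hd
  have hw : w = ‖fun j => (A.transpose.mulVec t j)⁻¹‖ := specNorm_inv_diagonal hd0
  have hW : specNorm (weight A t) = ‖A.transpose.mulVec t‖ := specNorm_diagonal _
  have hκ : κ = ‖A.transpose.mulVec t‖ * w := by rw [← hW]; rfl
  rw [← hw] at hn2 hn4
  have hw0 : 0 ≤ w := by rw [hw]; exact norm_nonneg _
  have hκ3 : κ < 3 := by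
    rw [hκ]
    calc _ < (3 / 2 : ℝ) * 2 := mul_lt_mul'' hn1 hn2 (norm_nonneg _) hw0
      _ = 3 := by norm_num
  have hnsp : NullSpaceProperty A q s ρ (1 / c) := by
    refine nullSpaceProperty_of_lower_bound hq hρ0 (by linarith) hc0 hs fun v hv => ?_
    refine le_trans ?_ (sum_pairDiff_sq_le (fun i => a i ω) μ v)
    refine le_trans ?_ (hFω ω hωF v hv)
    rw [hc2]
    exact mul_le_mul_of_nonneg_right (by linarith) (sq_nonneg _)
  refine ⟨hnsp, hd0, hκ3, hn2, ?_⟩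
  intro p hp hpq x₀ hx₀ z x hx
  -- The condition `κρ < 1` follows from `κ < 3` and `ρ < 1/3`.
  have h := hnsp.nnls_error_le (by linarith) hρ0.le (by positivity) hs hsn t hd0
    (norm_nonneg _) hw0 hn3 hn4 (by rw [← hκ]; nlinarith) hp hpq hx₀ hx
  rw [← hκ] at h
  rwa [show ellNorm 2 t = 1 / (√m * μ) from ellNorm_two_const hm0 hμ] at h
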